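/- Let $\mathfrak H$ be a complex Hilbert space; inner products are linear in the first slot, and operators are identified with their graphs, i.e. with linear relations (subspaces of $\mathfrak H\times\mathfrak H$). The adjoint of a relation $S$ is $S^*=\{\{g,g'\}:(f',g)=(f,g')\text{ for all }\{f,f'\}\in S\}$. A relation $B$ is dissipative if $\operatorname{Im}(f',f)\le 0$ for all $\{f,f'\}\in B$, and maximal dissipative if it has no proper dissipative extension (among linear relations) in $\mathfrak H$. A boundary triplet $\{\mathbb C^n,\Gamma_0,\Gamma_1\}$ for $S^*$ consists of linear maps $\Gamma_0,\Gamma_1:S^*\to\mathbb C^n$ such that $(f',g)-(f,g')=(\Gamma_1\hat f,\Gamma_0\hat g)-(\Gamma_0\hat f,\Gamma_1\hat g)$ for all $\hat f=\{f,f'\},\hat g=\{g,g'\}\in S^*$ and $(\Gamma_0,\Gamma_1):S^*\to\mathbb C^n\oplus\mathbb C^n$ is surjective. Let $A$ be a selfadjoint operator and $B$ a maximal dissipative operator in $\mathfrak H$ such that, for some $\lambda\in\rho(A)\cap\rho(B)$, the operator $(B-\lambda)^{-1}-(A-\lambda)^{-1}$ has range of dimension $n\in\mathbb N$. Let $S=A\cap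 B$, let $\{\mathbb C^n,\Gamma_0,\Gamma_1\}$ be a boundary triplet for $S^*$, and let $D$ be a dissipative $n\times n$ matrix with $\ker(\operatorname{Im}D)=\{0\}$ such that $A=\ker\Gamma_0$ and $B=\ker(\Gamma_1-D\Gamma_0)$; here $\operatorname{Re}D=\frac12(D+D^*)$ and $\operatorname{Im}D=\frac1{2i}(D-D^*)$. Let $T$ be the operator $Tg=-ig'$ in $L^2(\mathbb R,\mathbb C^n)$ with domain $\{g\in W^1_2(\mathbb R,\mathbb C^n):g(0)=0\}$, let $T^*$ be its adjoint, and for $\hat g=\{g,T^*g\}$ put $$\Upsilon_0\hat g=\tfrac1{\sqrt2}(-\operatorname{Im}D)^{-1/2}\bigl(g(0+)-g(0-)\bigr),\qquad \Upsilon_1\hat g=\tfrac{i}{\sqrt2}(-\operatorname{Im}D)^{1/2}\bigl(g(0+)+g(0-)\bigr),$$ where $g(0\pm)$ are the limits at $0$ of the continuous representatives of $g$ on $(0,\infty)$ and $(-\infty,0)$. Then the relation in $\mathfrak H\oplus L^2(\mathbb R,\mathbb C^n)$ $$L=\left\{\left\{\binom fg,\binom{f'}{T^*g}\right\}:\ \hat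 f=\{f,f'\}\in S^*,\ \hat g=\{g,T^*g\},\ \Gamma_0\hat f=\Upsilon_0\hat g,\ (\Gamma_1-\operatorname{Re}D\,\Gamma_0)\hat f=-\Upsilon_1\hat g\right\}$$ is (the graph of) a selfadjoint operator, and it is a minimal selfadjoint dilation of $B$: for all $\lambda\in\mathbb C_+$ one has $\lambda\in\rho(L)\cap\rho(B)$ and $$P_{\mathfrak H}(L-\lambda)^{-1}\upharpoonright_{\mathfrak H}=(B-\lambda)^{-1},$$ and $\mathfrak H\oplus L^2(\mathbb R,\mathbb C^n)$ is the closed linear span of $\{(L-\lambda)^{-1}\mathfrak H:\lambda\in\mathbb C\setminus\mathbb R\}$. -/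

import Mathlib

open MeasureTheory Filter Topology
open scoped ComplexStarModule

noncomputable section

namespace LinRel

variable {H : Type*} [NormedAddCommGroup H] [InnerProductSpace ℂ H]

/-- A linear relation `T` in `H` (a subspace of `H × H`) is dissipative if `Im (f', f) ≤ 0` for all
`{f, f'} ∈ T`. Mathlib's inner product is linear in the second slot, so `(f', f)` is
`inner ℂ f f'`. -/
def IsDissipative (T : Submodule ℂ (H × H)) : Prop :=
  ∀ p ∈ T, (inner ℂ p.1 p.2).im ≤ 0

/-- A dissipative relation without proper dissipative extensions (among linear relations) in `H`. -/
def IsMaximalDissipative (T : Submodule ℂ (H × H)) : Prop :=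
  IsDissipative T ∧ ∀ T' : Submodule ℂ (H × H), T ≤ T' → IsDissipative T' → T' = T

/-- The inverse `(T - z)⁻¹ = {{f' - z f, f} : {f, f'} ∈ T}` as a linear relation. -/
def inverseShift (T : Submodule ℂ (H × H)) (z : ℂ) : Submodule ℂ (H × H) :=
  T.map ((LinearMap.snd ℂ H H - z • LinearMap.fst ℂ H H).prod (LinearMap.fst ℂ H H))

/-- `z` belongs to the resolvent set of `T`, and the bounded everywhere defined operator `R` is the
resolvent `(T - z)⁻¹`. -/
def IsResolventAt (T : Submodule ℂ (H × H)) (z : ℂ) (R : H →L[ℂ] H) : Prop :=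
  inverseShift T z = (R : H →ₗ[ℂ] H).graph

end LinRel

/-- A boundary triplet `{G, Γ₀, Γ₁}` for the adjoint relation `S*` of a linear relation `S`. -/
structure BoundaryTriplet {H : Type*} [NormedAddCommGroup H] [InnerProductSpace ℂ H]
    (S : Submodule ℂ (H × H)) (G : Type*) [NormedAddCommGroup G] [InnerProductSpace ℂ G] where
  Γ₀ : S.adjoint →ₗ[ℂ] G
  Γ₁ : S.adjoint →ₗ[ℂ] G
  green : ∀ f g : S.adjoint,
    inner ℂ g.1.1 f.1.2 - inner ℂ g.1.2 f.1.1
      = inner ℂ (Γ₀ g) (Γ₁ f) - inner ℂ (Γ₁ g) (Γ₀ f)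
  surjective : Function.Surjective (Γ₀.prod Γ₁)

/-- A minimal selfadjoint dilation `L`, acting in the Hilbert space `H ⊕ K`, of an operator `B`
in `H`. -/
def IsMinimalSelfadjointDilation {H K : Type*}
    [NormedAddCommGroup H] [InnerProductSpace ℂ H] [CompleteSpace H]
    [NormedAddCommGroup K] [InnerProductSpace ℂ K] [CompleteSpace K]
    (L : WithLp 2 (H × K) →ₗ.[ℂ] WithLp 2 (H × K)) (B : H →ₗ.[ℂ] H) : Prop :=
  IsSelfAdjoint L ∧
  (∀ z : ℂ, 0 < z.im →
    ∃ (R : WithLp 2 (H × K) →L[ℂ] WithLp 2 (H × K)) (Q : H →L[ℂ] H),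
      LinRel.IsResolventAt L.graph z R ∧ LinRel.IsResolventAt B.graph z Q ∧
      ∀ h : H, (R (WithLp.toLp 2 (h, 0))).fst = Q h) ∧
  (Submodule.span ℂ {u : WithLp 2 (H × K) |
    ∃ (z : ℂ) (R : WithLp 2 (H × K) →L[ℂ] WithLp 2 (H × K)) (h : H),
      z.im ≠ 0 ∧ LinRel.IsResolventAt L.graph z R ∧
      u = R (WithLp.toLp 2 (h, 0))}).topologicalClosure = ⊤

namespace FirstOrder

/-- The Hilbert space `ℂⁿ`. -/
abbrev Cn (n : ℕ) := EuclideanSpace ℂ (Fin n)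

/-- The Hilbert space `L²(ℝ, ℂⁿ)`. -/
abbrev L2 (n : ℕ) := Lp (Cn n) 2 (volume : Measure ℝ)

variable {n : ℕ}

theorem intervalIntegrable_L2 (w : L2 n) (x y : ℝ) : IntervalIntegrable w volume x y :=
  intervalIntegrable_iff.2 <| (((Lp.memLp w).locallyIntegrable (by norm_num)).integrableOn_isCompact
    isCompact_uIcc).mono_set Set.uIoc_subset_uIcc

/-- The function `φ` is the locally absolutely continuous representative of `g ∈ W¹₂(ℝ, ℂⁿ)`, whose
derivative is `w ∈ L²(ℝ, ℂⁿ)`. -/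
def IsSobolevRep (φ : ℝ → Cn n) (g w : L2 n) : Prop :=
  φ =ᵐ[volume] g ∧ ∀ x y : ℝ, φ y - φ x = ∫ t in x..y, w t

/-- The graph of the operator `T g = -i g'` with domain `{g ∈ W¹₂(ℝ, ℂⁿ) : g(0) = 0}`
in `L²(ℝ, ℂⁿ)`. -/
def T (n : ℕ) : Submodule ℂ (L2 n × L2 n) where
  carrier := {p | ∃ (φ : ℝ → Cn n) (w : L2 n),
    IsSobolevRep φ p.1 w ∧ φ 0 = 0 ∧ p.2 = (-Complex.I) • w}
  zero_mem' := by
    refine ⟨0, 0, ⟨(Lp.coeFn_zero _ _ _).symm, fun x y => ?_⟩, rfl, by simp⟩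
    have h : ∀ᵐ t ∂volume, t ∈ Set.uIoc x y → ((0 : L2 n) : ℝ → Cn n) t = (fun _ => 0) t := by
      filter_upwards [Lp.coeFn_zero (Cn n) 2 (volume : Measure ℝ)] with t ht _
      exact ht
    rw [intervalIntegral.integral_congr_ae h]
    simp
  add_mem' := by
    rintro p q ⟨φ, w, ⟨h1, h2⟩, h3, h4⟩ ⟨ψ, v, ⟨k1, k2⟩, k3, k4⟩
    refine ⟨φ + ψ, w + v, ⟨(h1.add k1).trans (Lp.coeFn_add _ _).symm, fun x y => ?_⟩,
      by simp [h3, k3], by simp [h4, k4]⟩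
    have h : ∀ᵐ t ∂volume, t ∈ Set.uIoc x y →
        ((w + v : L2 n) : ℝ → Cn n) t = w t + v t := by
      filter_upwards [Lp.coeFn_add w v] with t ht _
      simpa using ht
    rw [intervalIntegral.integral_congr_ae h, intervalIntegral.integral_add
      (intervalIntegrable_L2 w x y) (intervalIntegrable_L2 v x y), ← h2, ← k2]
    simp only [Pi.add_apply]
    abel
  smul_mem' := by
    rintro c p ⟨φ, w, ⟨h1, h2⟩, h3, h4⟩
    refine ⟨c • φ, c • w, ⟨(h1.const_smul c).trans (Lp.coeFn_smul _ _).symm, fun x y => ?_⟩,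
      by simp [h3], by simp [h4, smul_comm c]⟩
    have h : ∀ᵐ t ∂volume, t ∈ Set.uIoc x y →
        ((c • w : L2 n) : ℝ → Cn n) t = c • w t := by
      filter_upwards [Lp.coeFn_smul c w] with t ht _
      simpa using ht
    rw [intervalIntegral.integral_congr_ae h, intervalIntegral.integral_smul, ← h2]
    simp only [Pi.smul_apply, smul_sub]

/-- `a` is the boundary value at `0` of `g` from within the half line `J` (`J = (0, ∞)` gives
`a = g(0+)`, `J = (-∞, 0)` gives `a = g(0-)`): the limit at `0` of the continuous representative
of `g` on `J`. -/
def IsBoundaryValue (J : Set ℝ) (g : L2 n) (a : Cn n) : Prop :=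
  ∃ φ : ℝ → Cn n, φ =ᵐ[volume.restrict J] g ∧ ContinuousOn φ J ∧ Tendsto φ (𝓝[J] 0) (𝓝 a)

theorem IsBoundaryValue.zero (J : Set ℝ) : IsBoundaryValue J (0 : L2 n) 0 :=
  ⟨0, ae_restrict_of_ae (Lp.coeFn_zero _ _ _).symm, continuousOn_const, tendsto_const_nhds⟩

theorem IsBoundaryValue.add {J : Set ℝ} {g h : L2 n} {a b : Cn n}
    (hg : IsBoundaryValue J g a) (hh : IsBoundaryValue J h b) :
    IsBoundaryValue J (g + h) (a + b) := by
  obtain ⟨φ, h1, h2, h3⟩ := hg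
  obtain ⟨ψ, k1, k2, k3⟩ := hh
  exact ⟨φ + ψ, (h1.add k1).trans (ae_restrict_of_ae (Lp.coeFn_add _ _).symm), h2.add k2, h3.add k3⟩

theorem IsBoundaryValue.smul {J : Set ℝ} {g : L2 n} {a : Cn n} (c : ℂ)
    (hg : IsBoundaryValue J g a) : IsBoundaryValue J (c • g) (c • a) := by
  obtain ⟨φ, h1, h2, h3⟩ := hg
  exact ⟨c • φ, (h1.const_smul c).trans (ae_restrict_of_ae (Lp.coeFn_smul _ _).symm),
    h2.const_smul c, h3.const_smul c⟩

open scoped MatrixOrder in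
/-- The matrix `(-Im D)^{1/2}`. -/
def sqrtNegIm (D : Matrix (Fin n) (Fin n) ℂ) : Matrix (Fin n) (Fin n) ℂ :=
  CFC.sqrt (-(ℑ D : Matrix (Fin n) (Fin n) ℂ))

/-- `Υ₀ ĝ = 2^{-1/2} (-Im D)^{-1/2} (a - b)` for `a = g(0+)` and `b = g(0-)`. -/
def upsilon₀ (D : Matrix (Fin n) (Fin n) ℂ) (a b : Cn n) : Cn n :=
  (1 / (Real.sqrt 2 : ℂ)) • Matrix.toEuclideanLin (sqrtNegIm D)⁻¹ (a - b)

/-- `Υ₁ ĝ = i 2^{-1/2} (-Im D)^{1/2} (a + b)` for `a = g(0+)` and `b = g(0-)`. -/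
def upsilon₁ (D : Matrix (Fin n) (Fin n) ℂ) (a b : Cn n) : Cn n :=
  (Complex.I / (Real.sqrt 2 : ℂ)) • Matrix.toEuclideanLin (sqrtNegIm D) (a + b)

end FirstOrder

open FirstOrder in
/-- The relation `L` in `H ⊕ L²(ℝ, ℂⁿ)`: all pairs `{(f, g), (f', g')}` with `f̂ = {f, f'} ∈ S*`,
`ĝ = {g, g'} ∈ T*`, `Γ₀ f̂ = Υ₀ ĝ` and `(Γ₁ - Re D Γ₀) f̂ = -Υ₁ ĝ`. -/
def couplingRelation {H : Type*} [NormedAddCommGroup H] [InnerProductSpace ℂ H] {n : ℕ}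
    {S : Submodule ℂ (H × H)} (Pi : BoundaryTriplet S (Cn n)) (D : Matrix (Fin n) (Fin n) ℂ) :
    Submodule ℂ (WithLp 2 (H × L2 n) × WithLp 2 (H × L2 n)) where
  carrier := {p | ∃ (hf : (p.1.fst, p.2.fst) ∈ S.adjoint) (a b : Cn n),
    (p.1.snd, p.2.snd) ∈ (T n).adjoint ∧
    IsBoundaryValue (Set.Ioi 0) p.1.snd a ∧ IsBoundaryValue (Set.Iio 0) p.1.snd b ∧
    Pi.Γ₀ ⟨_, hf⟩ = upsilon₀ D a b ∧
    Pi.Γ₁ ⟨_, hf⟩ - Matrix.toEuclideanLin (ℜ D : Matrix (Fin n) (Fin n) ℂ) (Pi.Γ₀ ⟨_, hf⟩)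
      = -upsilon₁ D a b}
  zero_mem' := by
    refine ⟨S.adjoint.zero_mem, 0, 0, (T n).adjoint.zero_mem, .zero _, .zero _, ?_, ?_⟩
    · exact (map_zero Pi.Γ₀).trans (by simp [upsilon₀])
    · have h0 : Pi.Γ₀ ⟨0, S.adjoint.zero_mem⟩ = 0 := map_zero Pi.Γ₀
      have h1 : Pi.Γ₁ ⟨0, S.adjoint.zero_mem⟩ = 0 := map_zero Pi.Γ₁
      refine (congrArg₂ (fun u v => u - Matrix.toEuclideanLin
        (ℜ D : Matrix (Fin n) (Fin n) ℂ) v) h1 h0).trans ?_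
      simp [upsilon₁]
  add_mem' := by
    rintro p q ⟨hf, a, b, h1, h2, h3, h4, h5⟩ ⟨kf, a', b', k1, k2, k3, k4, k5⟩
    have e0 : Pi.Γ₀ ⟨_, S.adjoint.add_mem hf kf⟩ = Pi.Γ₀ ⟨_, hf⟩ + Pi.Γ₀ ⟨_, kf⟩ :=
      map_add Pi.Γ₀ ⟨_, hf⟩ ⟨_, kf⟩
    have e1 : Pi.Γ₁ ⟨_, S.adjoint.add_mem hf kf⟩ = Pi.Γ₁ ⟨_, hf⟩ + Pi.Γ₁ ⟨_, kf⟩ :=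
      map_add Pi.Γ₁ ⟨_, hf⟩ ⟨_, kf⟩
    refine ⟨S.adjoint.add_mem hf kf, a + a', b + b', (T n).adjoint.add_mem h1 k1, h2.add k2,
      h3.add k3, ?_, ?_⟩
    · refine e0.trans ?_
      rw [h4, k4]
      simp only [upsilon₀, map_sub, map_add, smul_add, smul_sub]
      abel
    · refine (congrArg₂ (fun u v => u - Matrix.toEuclideanLin
        (ℜ D : Matrix (Fin n) (Fin n) ℂ) v) e1 e0).trans ?_
      have : -upsilon₁ D (a + a') (b + b') = -upsilon₁ D a b + -upsilon₁ D a' b' := by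
        simp only [upsilon₁, map_add, smul_add]
        abel
      rw [this, ← h5, ← k5]
      simp only [map_add]
      abel
  smul_mem' := by
    rintro c p ⟨hf, a, b, h1, h2, h3, h4, h5⟩
    have e0 : Pi.Γ₀ ⟨_, S.adjoint.smul_mem c hf⟩ = c • Pi.Γ₀ ⟨_, hf⟩ :=
      map_smul Pi.Γ₀ c ⟨_, hf⟩
    have e1 : Pi.Γ₁ ⟨_, S.adjoint.smul_mem c hf⟩ = c • Pi.Γ₁ ⟨_, hf⟩ :=
      map_smul Pi.Γ₁ c ⟨_, hf⟩
    refine ⟨S.adjoint.smul_mem c hf, c • a, c • b, (T n).adjoint.smul_mem c h1, h2.smul c,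
      h3.smul c, ?_, ?_⟩
    · refine e0.trans ?_
      rw [h4]
      simp only [upsilon₀, ← smul_sub, map_smul]
      rw [smul_comm]
    · refine (congrArg₂ (fun u v => u - Matrix.toEuclideanLin
        (ℜ D : Matrix (Fin n) (Fin n) ℂ) v) e1 e0).trans ?_
      have : -upsilon₁ D (c • a) (c • b) = c • -upsilon₁ D a b := by
        simp only [upsilon₁, ← smul_add, map_smul, smul_neg]
        rw [smul_comm]
      rw [this, ← h5]
      simp only [map_smul, smul_sub]

end

/-! The elements of T* are the pairs (g, -i g') with g in W¹₂ on each half line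
(`exists_hasTraces_of_mem_adjoint`). Integration by parts shows that (Υ₀, Υ₁) satisfies Green's
identity for T*, and it takes all values, so L couples two boundary triplets. On L the boundary
terms of the two Green identities cancel because Re D is Hermitian; hence L ⊆ L*. Conversely, L
contains S and T in the respective components, so L* lies in S* ⊕ T*, and pairing with elements of L
of arbitrary boundary values returns the two coupling conditions (`adjoint_couplingRelation`). L is
single-valued because T* is, and because Γ₀ = 0 leads back to the operator A.

Dilation: let Im z > 0 and (L - z)(f, g) = (h, 0). On the left half line g is a multiple of e^{izx},
which is square integrable there only if it is zero, so g(0-) = 0. Then Υ₁ = i(-Im D)Υ₀ and the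
coupling conditions collapse to Γ₁ = DΓ₀, that is, f lies in dom B and (B - z)f = h
(`boundary_condition_of_mem_couplingRelation`). Dissipativity of B makes f unique.

Minimality: if x is orthogonal to all (L - z)⁻¹H, then (L - z)⁻¹x = (0, g_z) for every nonreal z.
The boundary data of {0, x.fst} do not depend on z, so neither do the traces of g_z; yet these tend
to 0 along z = it. All traces therefore vanish. Hence x.fst = 0, since A is an operator, and x.snd
is orthogonal to the square integrable exponentials on both half lines, so it is 0 by Fourier
uniqueness (`eq_zero_of_inner_eq_zero`). -/

/-! ### Vector-valued absolutely continuous functions and integration by parts. -/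

section AbsolutelyContinuous

variable {E X Y : Type*} [PseudoMetricSpace X] [PseudoMetricSpace Y]

/-- Lets a scalar primitive of `‖w‖` control the increments of a vector-valued primitive of `w`. -/
theorem AbsolutelyContinuousOnInterval.of_dist_le {f : ℝ → X} {g : ℝ → Y} {a b C : ℝ}
    (hg : AbsolutelyContinuousOnInterval g a b)
    (h : ∀ x ∈ Set.uIcc a b, ∀ y ∈ Set.uIcc a b, dist (f x) (f y) ≤ C * dist (g x) (g y)) :
    AbsolutelyContinuousOnInterval f a b := by
  unfold AbsolutelyContinuousOnInterval at hg ⊢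
  refine squeeze_zero' (.of_forall fun _ => Finset.sum_nonneg fun _ _ => dist_nonneg) ?_
    (by simpa using hg.const_mul C)
  rw [eventually_inf_principal]
  filter_upwards with J hJ
  rw [Finset.mul_sum]
  exact Finset.sum_le_sum fun i hi => h _ (hJ.1 i hi).1 _ (hJ.1 i hi).2

variable [NormedAddCommGroup E]

theorem MeasureTheory.LocallyIntegrable.intervalIntegrable_real {w : ℝ → E}
    (hw : LocallyIntegrable w volume) (x y : ℝ) : IntervalIntegrable w volume x y :=
  intervalIntegrable_iff.2 <|
    (hw.integrableOn_isCompact isCompact_uIcc).mono_set Set.uIoc_subset_uIcc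

theorem AbsolutelyContinuousOnInterval.of_sub_eq_integral [NormedSpace ℝ E] {φ w : ℝ → E}
    (hw : LocallyIntegrable w volume) (h : ∀ x y, φ y - φ x = ∫ t in x..y, w t) (a b : ℝ) :
    AbsolutelyContinuousOnInterval φ a b := by
  have hn : LocallyIntegrable (fun t => ‖w t‖) volume := fun x => (hw x).norm
  refine ((hn.intervalIntegrable_real a b).absolutelyContinuousOnInterval_intervalIntegral
    (c := a) Set.left_mem_uIcc).of_dist_le (C := 1) fun x _ y _ => ?_
  rw [one_mul, dist_comm, dist_eq_norm, h, dist_comm, Real.dist_eq,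
    intervalIntegral.integral_interval_sub_left (hn.intervalIntegrable_real _ _)
      (hn.intervalIntegrable_real _ _)]
  exact intervalIntegral.norm_integral_le_abs_integral_norm

variable [InnerProductSpace ℂ E]

/-- Both factors are bounded on the interval, and an increment of the product splits as in the
product rule. -/
theorem absolutelyContinuousOnInterval_inner {φ ψ : ℝ → E} {a b : ℝ}
    (hφ : AbsolutelyContinuousOnInterval φ a b) (hψ : AbsolutelyContinuousOnInterval ψ a b) :
    AbsolutelyContinuousOnInterval (fun t => inner ℂ (φ t) (ψ t)) a b := by
  obtain ⟨C, hC⟩ := hφ.exists_bound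
  obtain ⟨K, hK⟩ := hψ.exists_bound
  unfold AbsolutelyContinuousOnInterval at hφ hψ ⊢
  refine squeeze_zero' (.of_forall fun _ => Finset.sum_nonneg fun _ _ => dist_nonneg) ?_
    (by simpa using (hψ.const_mul C).add (hφ.const_mul K))
  rw [eventually_inf_principal]
  filter_upwards with J hJ
  rw [Finset.mul_sum, Finset.mul_sum, ← Finset.sum_add_distrib]
  refine Finset.sum_le_sum fun i hi => ?_
  have h1 := hC _ (hJ.1 i hi).1
  have h2 := hK _ (hJ.1 i hi).2
  set x := (J.2 i).1
  set y := (J.2 i).2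
  have e : inner ℂ (φ x) (ψ x) - inner ℂ (φ y) (ψ y)
      = inner ℂ (φ x) (ψ x - ψ y) + inner ℂ (φ x - φ y) (ψ y) := by
    simp only [inner_sub_left, inner_sub_right]; ring
  rw [dist_eq_norm, dist_eq_norm, dist_eq_norm, e]
  refine (norm_add_le _ _).trans (add_le_add ?_ ?_)
  · exact (norm_inner_le_norm _ _).trans (by gcongr)
  · exact (norm_inner_le_norm _ _).trans (by rw [mul_comm]; gcongr)

/-- A primitive of a locally integrable function is continuous. -/
theorem continuous_of_sub_eq_integral {φ w : ℝ → E} (hw : LocallyIntegrable w volume)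
    (h : ∀ x y, φ y - φ x = ∫ t in x..y, w t) : Continuous φ := by
  have : φ = fun y => φ 0 + ∫ t in (0 : ℝ)..y, w t := by
    ext1 y; rw [← h]; abel
  rw [this]
  exact continuous_const.add
    (intervalIntegral.continuous_primitive (fun x y => hw.intervalIntegrable_real x y) 0)

theorem locallyIntegrable_inner_of_continuous {φ w : ℝ → E} (hφ : Continuous φ)
    (hw : LocallyIntegrable w volume) :
    LocallyIntegrable (fun t => inner ℂ (φ t) (w t)) volume := by
  rw [locallyIntegrable_iff] at hw ⊢
  intro k hk
  obtain ⟨C, hC⟩ := hk.exists_bound_of_continuousOn hφ.continuousOn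
  refine Integrable.mono' ((hw k hk).norm.const_mul C)
    (hφ.aestronglyMeasurable.inner (hw k hk).aestronglyMeasurable) ?_
  filter_upwards [ae_restrict_mem hk.measurableSet] with t ht
  exact (norm_inner_le_norm _ _).trans (by gcongr; exact hC t ht)

theorem locallyIntegrable_inner_of_continuous_right {ψ w : ℝ → E} (hψ : Continuous ψ)
    (hw : LocallyIntegrable w volume) :
    LocallyIntegrable (fun t => inner ℂ (w t) (ψ t)) volume := by
  rw [locallyIntegrable_iff]
  intro k hk
  have h := locallyIntegrable_iff.1 (locallyIntegrable_inner_of_continuous hψ hw) k hk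
  refine (Complex.conjCLE.toContinuousLinearMap.integrable_comp h).congr (.of_forall fun t => ?_)
  exact inner_conj_symm _ _

variable [CompleteSpace E]

theorem ae_hasDerivAt_of_sub_eq_integral {φ w : ℝ → E} (hw : LocallyIntegrable w volume)
    (h : ∀ x y, φ y - φ x = ∫ t in x..y, w t) : ∀ᵐ x, HasDerivAt φ (w x) x := by
  filter_upwards [_root_.LocallyIntegrable.ae_hasDerivAt_integral hw] with x hx
  have : φ = fun y => φ 0 + ∫ t in (0 : ℝ)..y, w t := by
    ext1 y; rw [← h]; abel
  rw [this]
  exact (hx 0).const_add _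

/-- Integration by parts for inner products of absolutely continuous functions. -/
theorem inner_sub_inner_eq_integral {φ ψ w v : ℝ → E}
    (hw : LocallyIntegrable w volume) (hv : LocallyIntegrable v volume)
    (hφ : ∀ x y, φ y - φ x = ∫ t in x..y, w t) (hψ : ∀ x y, ψ y - ψ x = ∫ t in x..y, v t)
    (x y : ℝ) :
    (inner ℂ (φ y) (ψ y) : ℂ) - inner ℂ (φ x) (ψ x)
      = ∫ t in x..y, (inner ℂ (φ t) (v t) + inner ℂ (w t) (ψ t)) := by
  have hφc := continuous_of_sub_eq_integral hw hφ
  have hψc := continuous_of_sub_eq_integral hv hψ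
  have hwi := locallyIntegrable_inner_of_continuous_right hψc hw
  have hi : LocallyIntegrable (fun t => (inner ℂ (φ t) (v t) : ℂ) + inner ℂ (w t) (ψ t)) volume :=
    (locallyIntegrable_inner_of_continuous hφc hv).add hwi
  -- The inner product minus the claimed integral is absolutely continuous with derivative zero
  -- almost everywhere, hence constant.
  have hac : AbsolutelyContinuousOnInterval
      (fun t => (inner ℂ (φ t) (ψ t) : ℂ)
        - ∫ s in x..t, (inner ℂ (φ s) (v s) + inner ℂ (w s) (ψ s))) x y := by
    refine AbsolutelyContinuousOnInterval.fun_sub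
      (absolutelyContinuousOnInterval_inner (.of_sub_eq_integral hw hφ x y)
        (.of_sub_eq_integral hv hψ x y)) (.of_sub_eq_integral hi (fun a b => ?_) x y)
    exact intervalIntegral.integral_interval_sub_left (hi.intervalIntegrable_real _ _)
      (hi.intervalIntegrable_real _ _)
  obtain ⟨C, hC⟩ := hac.const_of_ae_hasDerivAt_zero (by
    filter_upwards [ae_hasDerivAt_of_sub_eq_integral hw hφ,
      ae_hasDerivAt_of_sub_eq_integral hv hψ, _root_.LocallyIntegrable.ae_hasDerivAt_integral hi] with t h1 h2 h3 _
    have h4 := (h1.inner ℂ h2).sub (h3 x)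
    rw [sub_self] at h4
    exact h4)
  have h1 := hC x Set.left_mem_uIcc
  have h2 := hC y Set.right_mem_uIcc
  simp only [intervalIntegral.integral_same, sub_zero] at h1
  rw [h1, ← h2]
  ring

end AbsolutelyContinuous

/-! ### The fundamental theorem of calculus on half lines. -/

section ImproperIntegrals

variable {F G : ℝ → ℂ}

/-- Integrability of `G` gives `F` a limit at infinity; integrability of `F` forces that limit to be
0. -/
theorem integral_Ioi_eq_neg_of_sub_eq_integral (h : ∀ y, F y - F 0 = ∫ t in (0 : ℝ)..y, G t)
    (hF : IntegrableOn F (Set.Ioi 0)) (hG : IntegrableOn G (Set.Ioi 0)) :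
    ∫ t in Set.Ioi 0, G t = -F 0 := by
  have h1 := intervalIntegral_tendsto_integral_Ioi 0 hG tendsto_id
  have h2 : Tendsto F atTop (𝓝 (F 0 + ∫ t in Set.Ioi 0, G t)) := by
    refine (h1.const_add (F 0)).congr fun y => ?_
    rw [id, ← h]; ring
  have h3 := IntegrableAtFilter.eq_zero_of_tendsto ⟨_, Ioi_mem_atTop 0, hF⟩ (fun s hs => by
    obtain ⟨b, hb⟩ := mem_atTop_sets.1 hs
    rw [← top_le_iff, ← Real.volume_Ici (a := b)]
    exact measure_mono hb) h2
  linear_combination h3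

theorem integral_Iio_eq_of_sub_eq_integral (h : ∀ y, F y - F 0 = ∫ t in (0 : ℝ)..y, G t)
    (hF : IntegrableOn F (Set.Iio 0)) (hG : IntegrableOn G (Set.Iio 0)) :
    ∫ t in Set.Iio 0, G t = F 0 := by
  have h1 := intervalIntegral_tendsto_integral_Iic 0 (integrableOn_Iic_iff_integrableOn_Iio (by finiteness) |>.2 hG)
    tendsto_id
  rw [integral_Iic_eq_integral_Iio] at h1
  have h2 : Tendsto F atBot (𝓝 (F 0 - ∫ t in Set.Iio 0, G t)) := by
    refine (h1.const_sub (F 0)).congr fun y => ?_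
    rw [id, intervalIntegral.integral_symm, ← h]; ring
  have h3 := IntegrableAtFilter.eq_zero_of_tendsto ⟨_, Iio_mem_atBot 0, hF⟩ (fun s hs => by
    obtain ⟨b, hb⟩ := mem_atBot_sets.1 hs
    rw [← top_le_iff, ← Real.volume_Iic (a := b)]
    exact measure_mono hb) h2
  linear_combination -h3

end ImproperIntegrals

/-! ### Traces at 0 and Green's identity for -i d/dx on the punctured line. -/

namespace FirstOrder

variable {n : ℕ}

theorem locallyIntegrable_L2 (w : L2 n) : LocallyIntegrable w volume :=
  (Lp.memLp w).locallyIntegrable (by norm_num)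

theorem locallyIntegrable_I_smul (w : L2 n) :
    LocallyIntegrable (fun t => Complex.I • w t) volume :=
  (locallyIntegrable_L2 w).smul Complex.I

/-- The solution of `-i φ' = w`, `φ 0 = a`. -/
noncomputable def primitive (a : Cn n) (w : L2 n) (x : ℝ) : Cn n :=
  a + ∫ t in (0 : ℝ)..x, Complex.I • w t

@[simp]
theorem primitive_zero (a : Cn n) (w : L2 n) : primitive a w 0 = a := by simp [primitive]

theorem primitive_sub (a : Cn n) (w : L2 n) (x y : ℝ) :
    primitive a w y - primitive a w x = ∫ t in x..y, Complex.I • w t := by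
  rw [primitive, primitive, add_sub_add_left_eq_sub,
    intervalIntegral.integral_interval_sub_left
      ((locallyIntegrable_I_smul w).intervalIntegrable_real _ _)
      ((locallyIntegrable_I_smul w).intervalIntegrable_real _ _)]

theorem continuous_primitive (a : Cn n) (w : L2 n) : Continuous (primitive a w) :=
  continuous_of_sub_eq_integral (locallyIntegrable_I_smul w) (primitive_sub a w)

/-- `p = {g, g'}` satisfies `-i (dg/dx) = g'` on both half lines, with one-sided boundary values
`g(0+) = a` and `g(0-) = b`. -/
structure HasTraces (p : L2 n × L2 n) (a b : Cn n) : Prop where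
  right : p.1 =ᵐ[volume.restrict (Set.Ioi 0)] primitive a p.2
  left : p.1 =ᵐ[volume.restrict (Set.Iio 0)] primitive b p.2

theorem inner_primitive_sub (a c : Cn n) (w v : L2 n) (y : ℝ) :
    (inner ℂ (primitive a w y) (primitive c v y) : ℂ)
        - inner ℂ (primitive a w 0) (primitive c v 0)
      = ∫ t in (0 : ℝ)..y, (inner ℂ (primitive a w t) (Complex.I • v t)
        + inner ℂ (Complex.I • w t) (primitive c v t)) :=
  inner_sub_inner_eq_integral (locallyIntegrable_I_smul w) (locallyIntegrable_I_smul v)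
    (primitive_sub a w) (primitive_sub c v) 0 y

theorem integrable_wronskian (p q : L2 n × L2 n) :
    Integrable (fun x => (inner ℂ (p.1 x) (q.2 x) : ℂ) - inner ℂ (p.2 x) (q.1 x)) volume :=
  (L2.integrable_inner p.1 q.2).sub (L2.integrable_inner p.2 q.1)

/-- The factor i turns the Wronskian into the derivative of the inner product of the two primitives.
-/
theorem wronskian_ae_eq {p q : L2 n × L2 n} {a c : Cn n} {J : Set ℝ}
    (hp : p.1 =ᵐ[volume.restrict J] primitive a p.2)
    (hq : q.1 =ᵐ[volume.restrict J] primitive c q.2) :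
    (fun x => Complex.I * ((inner ℂ (p.1 x) (q.2 x) : ℂ) - inner ℂ (p.2 x) (q.1 x)))
      =ᵐ[volume.restrict J] fun t => inner ℂ (primitive a p.2 t) (Complex.I • q.2 t)
        + inner ℂ (Complex.I • p.2 t) (primitive c q.2 t) := by
  filter_upwards [hp, hq] with x h1 h2
  rw [← h1, ← h2, inner_smul_left, inner_smul_right, Complex.conj_I]
  ring

theorem integrableOn_inner_primitive {p q : L2 n × L2 n} {a c : Cn n} {J : Set ℝ}
    (hp : p.1 =ᵐ[volume.restrict J] primitive a p.2)
    (hq : q.1 =ᵐ[volume.restrict J] primitive c q.2) :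
    IntegrableOn (fun x => (inner ℂ (primitive a p.2 x) (primitive c q.2 x) : ℂ)) J := by
  refine (L2.integrable_inner p.1 q.1).integrableOn.congr ?_
  filter_upwards [hp, hq] with x h1 h2
  rw [h1, h2]

/-- Only the endpoint 0 contributes; the left half line gives the opposite sign. -/
theorem integral_Ioi_wronskian {p q : L2 n × L2 n} {a c : Cn n}
    (hp : p.1 =ᵐ[volume.restrict (Set.Ioi 0)] primitive a p.2)
    (hq : q.1 =ᵐ[volume.restrict (Set.Ioi 0)] primitive c q.2) :
    ∫ x in Set.Ioi 0, ((inner ℂ (p.1 x) (q.2 x) : ℂ) - inner ℂ (p.2 x) (q.1 x))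
      = Complex.I * inner ℂ a c := by
  have h := integral_Ioi_eq_neg_of_sub_eq_integral (inner_primitive_sub a c p.2 q.2)
    (integrableOn_inner_primitive hp hq)
    (((integrable_wronskian p q).integrableOn.const_mul _).congr (wronskian_ae_eq hp hq))
  rw [← integral_congr_ae (wronskian_ae_eq hp hq), integral_const_mul, primitive_zero,
    primitive_zero] at h
  linear_combination -Complex.I * h + (∫ x in Set.Ioi 0,
    ((inner ℂ (p.1 x) (q.2 x) : ℂ) - inner ℂ (p.2 x) (q.1 x))) * Complex.I_sq

theorem integral_Iio_wronskian {p q : L2 n × L2 n} {a c : Cn n}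
    (hp : p.1 =ᵐ[volume.restrict (Set.Iio 0)] primitive a p.2)
    (hq : q.1 =ᵐ[volume.restrict (Set.Iio 0)] primitive c q.2) :
    ∫ x in Set.Iio 0, ((inner ℂ (p.1 x) (q.2 x) : ℂ) - inner ℂ (p.2 x) (q.1 x))
      = -Complex.I * inner ℂ a c := by
  have h := integral_Iio_eq_of_sub_eq_integral (inner_primitive_sub a c p.2 q.2)
    (integrableOn_inner_primitive hp hq)
    (((integrable_wronskian p q).integrableOn.const_mul _).congr (wronskian_ae_eq hp hq))
  rw [← integral_congr_ae (wronskian_ae_eq hp hq), integral_const_mul, primitive_zero,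
    primitive_zero] at h
  linear_combination -Complex.I * h + (∫ x in Set.Iio 0,
    ((inner ℂ (p.1 x) (q.2 x) : ℂ) - inner ℂ (p.2 x) (q.1 x))) * Complex.I_sq

/-- Green's identity on the punctured line. -/
theorem HasTraces.green {p q : L2 n × L2 n} {a b c d : Cn n} (hp : HasTraces p a b)
    (hq : HasTraces q c d) :
    (inner ℂ p.1 q.2 : ℂ) - inner ℂ p.2 q.1
      = Complex.I * (inner ℂ a c - inner ℂ b d) := by
  rw [L2.inner_def, L2.inner_def, ← integral_sub (L2.integrable_inner p.1 q.2)
    (L2.integrable_inner p.2 q.1), ← intervalIntegral.integral_Iic_add_Ioi (b := 0)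
    (integrable_wronskian p q).integrableOn (integrable_wronskian p q).integrableOn,
    integral_Iic_eq_integral_Iio, integral_Ioi_wronskian hp.right hq.right,
    integral_Iio_wronskian hp.left hq.left]
  ring

theorem hasTraces_zero_of_mem_T {p : L2 n × L2 n} (hp : p ∈ T n) : HasTraces p 0 0 := by
  obtain ⟨φ, w, ⟨h1, h2⟩, h3, h4⟩ := hp
  have h : p.1 =ᵐ[volume] primitive 0 p.2 := by
    filter_upwards [h1] with x hx
    have e : φ x = ∫ t in (0 : ℝ)..x, w t := by rw [← h2, h3, sub_zero]
    rw [← hx, e, primitive, zero_add]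
    refine intervalIntegral.integral_congr_ae ?_
    filter_upwards [Lp.coeFn_smul (-Complex.I) w] with t ht _
    rw [h4, ht, Pi.smul_apply, smul_smul]
    simp
  exact ⟨ae_restrict_of_ae h, ae_restrict_of_ae h⟩

theorem HasTraces.mem_adjoint {p : L2 n × L2 n} {a b : Cn n} (hp : HasTraces p a b) :
    p ∈ (T n).adjoint := by
  rw [Submodule.mem_adjoint_iff]
  intro u v huv
  have := (hasTraces_zero_of_mem_T huv).green hp
  simp only [inner_zero_left, sub_self, mul_zero] at this
  linear_combination -this

theorem HasTraces.isBoundaryValue_right {p : L2 n × L2 n} {a b : Cn n} (hp : HasTraces p a b) :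
    IsBoundaryValue (Set.Ioi 0) p.1 a := by
  refine ⟨primitive a p.2, hp.right.symm, (continuous_primitive _ _).continuousOn, ?_⟩
  have h := (continuous_primitive a p.2).continuousWithinAt (s := Set.Ioi 0) (x := 0)
  rwa [ContinuousWithinAt, primitive_zero] at h

theorem HasTraces.isBoundaryValue_left {p : L2 n × L2 n} {a b : Cn n} (hp : HasTraces p a b) :
    IsBoundaryValue (Set.Iio 0) p.1 b := by
  refine ⟨primitive b p.2, hp.left.symm, (continuous_primitive _ _).continuousOn, ?_⟩
  have h := (continuous_primitive b p.2).continuousWithinAt (s := Set.Iio 0) (x := 0)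
  rwa [ContinuousWithinAt, primitive_zero] at h

theorem IsBoundaryValue.unique {J : Set ℝ} (hJ : IsOpen J) [(𝓝[J] (0 : ℝ)).NeBot] {g : L2 n}
    {a b : Cn n} (ha : IsBoundaryValue J g a) (hb : IsBoundaryValue J g b) : a = b := by
  obtain ⟨φ, h1, h2, h3⟩ := ha
  obtain ⟨ψ, k1, k2, k3⟩ := hb
  have h : Set.EqOn φ ψ J := Measure.eqOn_open_of_ae_eq (h1.trans k1.symm) hJ h2 k2
  exact tendsto_nhds_unique h3 (k3.congr' (eventually_nhdsWithin_of_forall fun x hx => (h hx).symm))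

end FirstOrder

/-! ### The adjoint of T: its elements have traces. -/

/-- All the constants agree, since each `I m` contains the non-null set `I 0`. -/
theorem exists_ae_eq_const_iUnion {X E : Type*} [MeasurableSpace X] {μ : Measure X} {u : X → E}
    {I : ℕ → Set X} (hI : Monotone I) (h0 : μ (I 0) ≠ 0)
    (h : ∀ m, ∃ c, ∀ᵐ x ∂μ.restrict (I m), u x = c) :
    ∃ c, ∀ᵐ x ∂μ.restrict (⋃ m, I m), u x = c := by
  choose c hc using h
  refine ⟨c 0, ?_⟩
  rw [ae_restrict_iUnion_iff]
  intro m
  have : (ae (μ.restrict (I 0))).NeBot := by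
    rw [ae_neBot, Ne, Measure.restrict_eq_zero]
    exact h0
  obtain ⟨x, h1, h2⟩ :=
    ((hc 0).and (ae_mono (Measure.restrict_mono_set μ (hI (Nat.zero_le m))) (hc m))).exists
  rw [← h1, h2]
  exact hc m

namespace FirstOrder

variable {n : ℕ}

/-- The du Bois-Reymond lemma for the adjoint of `T` on an interval that avoids `0`. -/
theorem exists_ae_sub_primitive_eq_const {p : L2 n × L2 n} (hp : p ∈ (T n).adjoint) {α β : ℝ}
    (hαβ : α < β) (h0 : (0 : ℝ) ∉ Set.Ioo α β) :
    ∃ c, ∀ᵐ x ∂volume.restrict (Set.Ioc α β), p.1 x - primitive 0 p.2 x = c := by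
  set Φ := primitive 0 p.2 with hΦ
  have hΦc : Continuous Φ := continuous_primitive 0 p.2
  set u : ℝ → Cn n := fun x => p.1 x - Φ x with hu
  have hui : LocallyIntegrable u volume := (locallyIntegrable_L2 p.1).sub hΦc.locallyIntegrable
  -- Subtracting the mean makes the primitive ψ of `k₀` vanish at both ends of the interval, hence
  -- outside it.
  set c : Cn n := (β - α)⁻¹ • ∫ t in α..β, u t with hc
  have huc : ∫ t in α..β, (u t - c) = 0 := by
    rw [intervalIntegral.integral_sub (hui.intervalIntegrable_real _ _)
      intervalIntegrable_const, intervalIntegral.integral_const, hc, smul_smul,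
      mul_inv_cancel₀ (sub_pos.2 hαβ).ne', one_smul, sub_self]
  set k₀ : ℝ → Cn n := (Set.Ioc α β).indicator fun x => u x - c with hk₀
  have hk₀m : MemLp k₀ 2 volume := by
    obtain ⟨C, hC⟩ := isCompact_Icc.exists_bound_of_continuousOn (s := Set.Icc α β)
      (f := fun x => Φ x + c) (by fun_prop)
    have h1 : MemLp ((Set.Ioc α β).indicator fun x => Φ x + c) 2 volume := by
      rw [memLp_indicator_iff_restrict measurableSet_Ioc]
      refine MemLp.of_bound (C := C) (by fun_prop) ?_
      filter_upwards [ae_restrict_mem measurableSet_Ioc] with x hx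
      exact hC x (Set.Ioc_subset_Icc_self hx)
    have h2 : MemLp ((Set.Ioc α β).indicator p.1) 2 volume :=
      (Lp.memLp p.1).indicator measurableSet_Ioc
    refine (h2.sub h1).ae_eq (.of_forall fun x => ?_)
    by_cases hx : x ∈ Set.Ioc α β <;> simp [hk₀, hu, hx, sub_sub]
  set k : L2 n := hk₀m.toLp k₀ with hk
  have hkk : k =ᵐ[volume] k₀ := hk₀m.coeFn_toLp
  have hk₀i : LocallyIntegrable k₀ volume := hk₀m.locallyIntegrable (by norm_num)
  set ψ : ℝ → Cn n := fun x => ∫ t in α..x, k₀ t with hψ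
  have hψs : ∀ x y, ψ y - ψ x = ∫ t in x..y, k₀ t := fun x y =>
    intervalIntegral.integral_interval_sub_left (hk₀i.intervalIntegrable_real _ _)
      (hk₀i.intervalIntegrable_real _ _)
  have hψc : Continuous ψ := continuous_of_sub_eq_integral hk₀i hψs
  have hψα : ψ α = 0 := by simp [hψ]
  have hψβ : ψ β = 0 := by
    rw [← huc]
    refine intervalIntegral.integral_congr_ae (.of_forall fun x hx => ?_)
    rw [Set.uIoc_of_le hαβ.le] at hx
    simp [hk₀, hx]
  have hψ0 : ∀ x ∉ Set.Ioo α β, ψ x = 0 := by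
    intro x hx
    rcases le_or_gt x α with h | h
    · have e := hψs α x
      rw [hψα, sub_zero] at e
      rw [e, intervalIntegral.integral_symm, neg_eq_zero]
      refine intervalIntegral.integral_zero_ae (.of_forall fun t ht => ?_)
      rw [Set.uIoc_of_le h] at ht
      exact Set.indicator_of_notMem (fun h' => absurd h'.1 (not_lt.2 ht.2)) _
    · have h' : β ≤ x := not_lt.1 fun h' => hx ⟨h, h'⟩
      have e := hψs β x
      rw [hψβ, sub_zero] at e
      rw [e]
      refine intervalIntegral.integral_zero_ae (.of_forall fun t ht => ?_)
      rw [Set.uIoc_of_le h'] at ht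
      exact Set.indicator_of_notMem (fun h' => absurd h'.2 (not_le.2 ht.1)) _
  have hψm : MemLp ψ 2 volume := hψc.memLp_of_hasCompactSupport
    (HasCompactSupport.intro isCompact_Icc fun x hx =>
      hψ0 x fun h => hx (Set.Ioo_subset_Icc_self h))
  have hψψ : hψm.toLp ψ =ᵐ[volume] ψ := hψm.coeFn_toLp
  -- Since 0 is not in the open interval, ψ(0) = 0, and ψ is an admissible test function.
  have hT : (hψm.toLp ψ, (-Complex.I) • k) ∈ T n := by
    refine ⟨ψ, k, ⟨hψψ.symm, fun x y => ?_⟩, hψ0 0 h0, rfl⟩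
    rw [hψs]
    refine intervalIntegral.integral_congr_ae ?_
    filter_upwards [hkk] with t ht _
    exact ht.symm
  have hadj := (Submodule.mem_adjoint_iff _ _).1 hp _ _ hT
  have hA : inner ℂ k p.1 = ∫ t in α..β, (inner ℂ (k₀ t) (p.1 t) : ℂ) := by
    rw [L2.inner_def, intervalIntegral.integral_eq_integral_of_support_subset]
    · refine integral_congr_ae ?_
      filter_upwards [hkk] with t ht
      rw [ht]
    · intro t ht
      by_contra h
      simp [hk₀, h] at ht
  have hK : inner ℂ k k = ∫ t in α..β, (inner ℂ (k₀ t) (k₀ t) : ℂ) := by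
    rw [L2.inner_def, intervalIntegral.integral_eq_integral_of_support_subset]
    · refine integral_congr_ae ?_
      filter_upwards [hkk] with t ht
      rw [ht]
    · intro t ht
      by_contra h
      simp [hk₀, h] at ht
  have hB : Complex.I * inner ℂ (hψm.toLp ψ) p.2
      = ∫ t in α..β, (inner ℂ (ψ t) (Complex.I • p.2 t) : ℂ) := by
    rw [L2.inner_def, intervalIntegral.integral_eq_integral_of_support_subset,
      ← integral_const_mul]
    · refine integral_congr_ae ?_
      filter_upwards [hψψ] with t ht
      rw [ht, inner_smul_right]
    · intro t ht
      by_contra h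
      rw [Function.mem_support, hψ0 t fun h' => h (Set.Ioo_subset_Ioc_self h'),
        inner_zero_left] at ht
      exact ht rfl
  have hB' := locallyIntegrable_inner_of_continuous hψc (locallyIntegrable_I_smul p.2)
  have hC' := locallyIntegrable_inner_of_continuous_right hΦc hk₀i
  have hE' := locallyIntegrable_inner_of_continuous_right (continuous_const (y := c)) hk₀i
  have hA' : IntervalIntegrable (fun t => (inner ℂ (k₀ t) (p.1 t) : ℂ)) volume α β := by
    refine Integrable.intervalIntegrable ((L2.integrable_inner (𝕜 := ℂ) k p.1).congr ?_)
    filter_upwards [hkk] with t ht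
    rw [ht]
  have hparts := inner_sub_inner_eq_integral hk₀i (locallyIntegrable_I_smul p.2) hψs
    (primitive_sub 0 p.2) α β
  rw [intervalIntegral.integral_add (hB'.intervalIntegrable_real _ _)
    (hC'.intervalIntegrable_real _ _), ← hB, hψα, hψβ, inner_zero_left, inner_zero_left,
    sub_zero] at hparts
  have hE : ∫ t in α..β, (inner ℂ (k₀ t) c : ℂ) = 0 := by
    have h1 : ∫ t in α..β, (inner ℂ c (k₀ t) : ℂ) = inner ℂ c (ψ β) :=
      (innerSL ℂ c).intervalIntegral_comp_comm (hk₀i.intervalIntegrable_real α β)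
    rw [hψβ, inner_zero_right] at h1
    have h2 := congrArg (starRingEnd ℂ) h1
    rw [map_zero, intervalIntegral.integral_of_le hαβ.le, ← integral_conj] at h2
    rw [intervalIntegral.integral_of_le hαβ.le, ← h2]
    simp only [inner_conj_symm]
  have hsplit : ∫ t in α..β, (inner ℂ (k₀ t) (k₀ t) : ℂ)
      = (∫ t in α..β, (inner ℂ (k₀ t) (p.1 t) : ℂ)) - (∫ t in α..β, (inner ℂ (k₀ t) (Φ t) : ℂ))
        - ∫ t in α..β, (inner ℂ (k₀ t) c : ℂ) := by
    rw [← intervalIntegral.integral_sub hA' (hC'.intervalIntegrable_real _ _),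
      ← intervalIntegral.integral_sub (hA'.sub (hC'.intervalIntegrable_real _ _))
        (hE'.intervalIntegrable_real _ _)]
    refine intervalIntegral.integral_congr_ae (.of_forall fun t ht => ?_)
    rw [Set.uIoc_of_le hαβ.le] at ht
    have : k₀ t = p.1 t - Φ t - c := by simp [hk₀, ht, hu]
    nth_rewrite 2 [this]
    simp only [inner_sub_right]
  -- ⟨k, k⟩ = ⟨k, p.1⟩ - ⟨k, Φ⟩ - ⟨k, c⟩. The first two terms cancel by the adjoint relation and
  -- integration by parts; the third vanishes because `k₀` has integral 0.
  have hzero : inner ℂ k k = (0 : ℂ) := by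
    rw [inner_smul_left, map_neg, Complex.conj_I, neg_neg] at hadj
    rw [hK, hsplit, ← hA, hE]
    linear_combination -Complex.I * hadj + hparts + inner ℂ k p.1 * Complex.I_sq
  have hk0 : k₀ =ᵐ[volume] 0 := by
    have : k = 0 := inner_self_eq_zero.1 hzero
    refine hkk.symm.trans ?_
    rw [this]
    exact Lp.coeFn_zero _ _ _
  refine ⟨c, ?_⟩
  filter_upwards [ae_restrict_of_ae hk0, ae_restrict_mem measurableSet_Ioc] with x hx hx'
  simpa [hk₀, hx', sub_eq_zero] using hx

theorem exists_hasTraces_of_mem_adjoint {p : L2 n × L2 n} (hp : p ∈ (T n).adjoint) :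
    ∃ a b, HasTraces p a b := by
  have key : ∀ (a : Cn n) (x : ℝ), p.1 x - primitive 0 p.2 x = a → p.1 x = primitive a p.2 x := by
    intro a x h
    rw [← h, primitive, primitive]; abel
  obtain ⟨a, ha⟩ := exists_ae_eq_const_iUnion (μ := volume)
    (u := fun x => p.1 x - primitive 0 p.2 x) (I := fun m : ℕ => Set.Ioc (0 : ℝ) (m + 1))
    (fun i j h => Set.Ioc_subset_Ioc_right (by gcongr)) (by simp)
    (fun m => exists_ae_sub_primitive_eq_const hp (by positivity) (by simp))
  obtain ⟨b, hb⟩ := exists_ae_eq_const_iUnion (μ := volume)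
    (u := fun x => p.1 x - primitive 0 p.2 x) (I := fun m : ℕ => Set.Ioc (-(m + 1) : ℝ) 0)
    (fun i j h => Set.Ioc_subset_Ioc_left (by gcongr)) (by simp)
    (fun m => exists_ae_sub_primitive_eq_const hp (by linarith [m.cast_nonneg (α := ℝ)]) (by simp))
  refine ⟨a, b, ?_, ?_⟩
  · refine (ae_restrict_of_ae_restrict_of_subset (fun x hx => ?_) ha).mono fun x => key a x
    obtain ⟨m, hm⟩ := exists_nat_ge x
    exact Set.mem_iUnion.2 ⟨m, hx, by linarith⟩
  · refine (ae_restrict_of_ae_restrict_of_subset (fun x (hx : x < 0) => ?_) hb).mono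
      fun x => key b x
    obtain ⟨m, hm⟩ := exists_nat_ge (-x)
    exact Set.mem_iUnion.2 ⟨m, by linarith, hx.le⟩

end FirstOrder

/-! ### Injectivity of the Fourier transform on L¹. -/

section Fourier

open scoped FourierTransform ContDiff

/-- An integrable function with vanishing Fourier transform vanishes almost everywhere. -/
theorem ae_eq_zero_of_fourier_eq_zero {E : Type*} [NormedAddCommGroup E] [NormedSpace ℂ E]
    [CompleteSpace E] {F : ℝ → E} (hF : Integrable F volume) (h : ∀ s, 𝓕 F s = 0) :
    F =ᵐ[volume] 0 := by
  refine ae_eq_zero_of_integral_contDiff_smul_eq_zero hF.locallyIntegrable fun g hg hgc => ?_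
  have hg₁ : HasCompactSupport (Complex.ofRealCLM ∘ g) := hgc.comp_left rfl
  have hg₂ : ContDiff ℝ ∞ (Complex.ofRealCLM ∘ g) := by fun_prop
  -- With 𝓕G = g, moving the transform across gives ∫ gF = ∫ 𝓕G · F = ∫ G · 𝓕F = 0.
  set G : SchwartzMap ℝ ℂ := 𝓕⁻ (hg₁.toSchwartzMap hg₂) with hG
  have hGf : 𝓕 (G : ℝ → ℂ) = Complex.ofRealCLM ∘ g := by
    rw [← SchwartzMap.fourier_coe, hG, FourierTransform.fourier_fourierInv_eq]
    rfl
  have key := VectorFourier.integral_fourierIntegral_smul_eq_flip (L := innerₗ ℝ)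
    Real.continuous_fourierChar continuous_inner (G.integrable (μ := volume)) hF
  have e1 : VectorFourier.fourierIntegral Real.fourierChar volume (innerₗ ℝ) (G : ℝ → ℂ)
      = Complex.ofRealCLM ∘ g := hGf
  have e2 : VectorFourier.fourierIntegral Real.fourierChar volume (innerₗ ℝ).flip F = 0 := by
    rw [flip_innerₗ]
    exact funext h
  rw [e1, e2] at key
  simpa using key

end Fourier

/-! ### Trace estimates, exponential solutions and their completeness. -/

namespace FirstOrder

variable {n : ℕ}

theorem inner_self_eq_ofReal {E : Type*} [NormedAddCommGroup E] [InnerProductSpace ℂ E] (x : E) :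
    (inner ℂ x x : ℂ) = ((‖x‖ ^ 2 : ℝ) : ℂ) := by
  rw [inner_self_eq_norm_sq_to_K]
  push_cast
  rfl

/-- Boundary values are unique, so those in the definition of L are the constants of integration on
the half lines. -/
theorem hasTraces_iff {p : L2 n × L2 n} {a b : Cn n} :
    HasTraces p a b ↔ p ∈ (T n).adjoint ∧ IsBoundaryValue (Set.Ioi 0) p.1 a ∧
      IsBoundaryValue (Set.Iio 0) p.1 b := by
  refine ⟨fun h => ⟨h.mem_adjoint, h.isBoundaryValue_right, h.isBoundaryValue_left⟩, ?_⟩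
  rintro ⟨h1, h2, h3⟩
  obtain ⟨a', b', h⟩ := exists_hasTraces_of_mem_adjoint h1
  rw [h2.unique isOpen_Ioi h.isBoundaryValue_right, h3.unique isOpen_Iio h.isBoundaryValue_left]
  exact h

theorem HasTraces.add {p q : L2 n × L2 n} {a b c d : Cn n} (hp : HasTraces p a b)
    (hq : HasTraces q c d) : HasTraces (p + q) (a + c) (b + d) :=
  hasTraces_iff.2 ⟨add_mem hp.mem_adjoint hq.mem_adjoint,
    hp.isBoundaryValue_right.add hq.isBoundaryValue_right,
    hp.isBoundaryValue_left.add hq.isBoundaryValue_left⟩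

theorem norm_setIntegral_inner_le {J : Set ℝ} (hJ : MeasurableSet J) (g h : L2 n) :
    ‖∫ x in J, (inner ℂ (g x) (h x) : ℂ)‖ ≤ ‖g‖ * ‖h‖ := by
  set k : L2 n := ((Lp.memLp g).indicator hJ).toLp _ with hk
  have hkk : k =ᵐ[volume] J.indicator g := MemLp.coeFn_toLp _
  have e : ∫ x in J, (inner ℂ (g x) (h x) : ℂ) = inner ℂ k h := by
    rw [L2.inner_def, ← integral_indicator hJ]
    refine integral_congr_ae ?_
    filter_upwards [hkk] with x hx
    rw [hx]
    by_cases hxJ : x ∈ J <;> simp [hxJ]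
  rw [e]
  refine (norm_inner_le_norm _ _).trans ?_
  gcongr
  refine Lp.norm_le_norm_of_ae_le ?_
  filter_upwards [hkk] with x hx
  rw [hx]
  exact norm_indicator_le_norm_self _ _

theorem norm_setIntegral_wronskian_le {J : Set ℝ} (hJ : MeasurableSet J) (p : L2 n × L2 n) :
    ‖∫ x in J, ((inner ℂ (p.1 x) (p.2 x) : ℂ) - inner ℂ (p.2 x) (p.1 x))‖
      ≤ 2 * (‖p.1‖ * ‖p.2‖) := by
  rw [integral_sub (L2.integrable_inner (𝕜 := ℂ) p.1 p.2).restrict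
    (L2.integrable_inner (𝕜 := ℂ) p.2 p.1).restrict]
  refine (norm_sub_le _ _).trans ?_
  have h1 := norm_setIntegral_inner_le hJ p.1 p.2
  have h2 := norm_setIntegral_inner_le hJ p.2 p.1
  linarith

/-- Green's identity on the half line for the pair (p, p), followed by Cauchy–Schwarz. -/
theorem HasTraces.norm_sq_right_le {p : L2 n × L2 n} {a b : Cn n} (hp : HasTraces p a b) :
    ‖a‖ ^ 2 ≤ 2 * (‖p.1‖ * ‖p.2‖) := by
  have h := norm_setIntegral_wronskian_le measurableSet_Ioi (J := Set.Ioi 0) p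
  rw [integral_Ioi_wronskian hp.right hp.right, inner_self_eq_norm_sq_to_K] at h
  simpa using h

theorem HasTraces.norm_sq_left_le {p : L2 n × L2 n} {a b : Cn n} (hp : HasTraces p a b) :
    ‖b‖ ^ 2 ≤ 2 * (‖p.1‖ * ‖p.2‖) := by
  have h := norm_setIntegral_wronskian_le measurableSet_Iio (J := Set.Iio 0) p
  rw [integral_Iio_wronskian hp.left hp.left, inner_self_eq_norm_sq_to_K] at h
  simpa using h

/-- Square integrable solutions of `-i g' = z g` on the left half line vanish if `Im z > 0`. -/
theorem HasTraces.left_eq_zero {g : L2 n} {z : ℂ} {a b : Cn n} (hz : 0 < z.im)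
    (h : HasTraces (g, z • g) a b) : b = 0 := by
  have h1 := integral_Iio_wronskian h.left h.left
  have e : ∫ x in Set.Iio (0 : ℝ), ((inner ℂ (g x) ((z • g : L2 n) x) : ℂ)
      - inner ℂ ((z • g : L2 n) x) (g x))
      = 2 * z.im * Complex.I * ((∫ x in Set.Iio (0 : ℝ), ‖g x‖ ^ 2 : ℝ) : ℂ) := by
    rw [← integral_complex_ofReal, ← integral_const_mul]
    refine integral_congr_ae (ae_restrict_of_ae ?_)
    filter_upwards [Lp.coeFn_smul z g] with x hx
    rw [hx, Pi.smul_apply, inner_smul_left, inner_smul_right, inner_self_eq_ofReal,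
      ← sub_mul, Complex.sub_conj]
    push_cast
    ring
  rw [e, inner_self_eq_ofReal] at h1
  have h2 := congrArg Complex.im h1
  have h3 : 0 ≤ ∫ x in Set.Iio (0 : ℝ), ‖g x‖ ^ 2 := integral_nonneg fun x => by positivity
  -- The two sides have opposite signs, so both vanish.
  have h4 : 2 * z.im * (∫ x in Set.Iio (0 : ℝ), ‖g x‖ ^ 2) = -‖b‖ ^ 2 := by
    simpa [-Complex.ofReal_pow] using h2
  have h7 : ‖b‖ ^ 2 ≤ 0 := by nlinarith [mul_nonneg hz.le h3]
  have h8 : ‖b‖ = 0 := by nlinarith [norm_nonneg b]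
  exact norm_eq_zero.1 h8

/-- The solution `x ↦ e^{iwx} c` of `-i g' = w g`. -/
noncomputable def expSol (w : ℂ) (c : Cn n) (x : ℝ) : Cn n :=
  Complex.exp (Complex.I * w * x) • c

theorem hasDerivAt_expSol (w : ℂ) (c : Cn n) (x : ℝ) :
    HasDerivAt (expSol w c) (Complex.I • w • expSol w c x) x := by
  have h1 : HasDerivAt (fun y : ℝ => Complex.I * w * (y : ℂ)) (Complex.I * w) x := by
    simpa using (Complex.ofRealCLM.hasDerivAt (x := x)).const_mul (Complex.I * w)
  have h2 := (h1.cexp).smul_const c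
  have e : Complex.I • w • expSol w c x
      = (Complex.exp (Complex.I * w * x) * (Complex.I * w)) • c := by
    rw [expSol, smul_smul, smul_smul]
    congr 1
    ring
  rw [e]
  exact h2

theorem continuous_expSol (w : ℂ) (c : Cn n) : Continuous (expSol w c) := by
  unfold expSol; fun_prop

theorem norm_expSol (w : ℂ) (c : Cn n) (x : ℝ) :
    ‖expSol w c x‖ = Real.exp (-w.im * x) * ‖c‖ := by
  rw [expSol, norm_smul, Complex.norm_exp]
  congr 2
  simp

theorem memLp_indicator_expSol {w : ℂ} {J : Set ℝ} (hJ : MeasurableSet J)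
    (h : IntegrableOn (fun x => Real.exp (-(2 * w.im) * x)) J) (c : Cn n) :
    MemLp (J.indicator (expSol w c)) 2 volume := by
  rw [memLp_indicator_iff_restrict hJ,
    memLp_two_iff_integrable_sq_norm (continuous_expSol w c).aestronglyMeasurable]
  refine (h.mul_const (‖c‖ ^ 2)).congr (.of_forall fun x => ?_)
  dsimp only
  rw [norm_expSol, mul_pow, ← Real.exp_nat_mul]
  congr 2
  push_cast
  ring

theorem primitive_indicator_expSol {w : ℂ} {J : Set ℝ} {c : Cn n}
    (hm : MemLp (J.indicator (expSol w c)) 2 volume) {x : ℝ} (hx : Set.uIoc 0 x ⊆ J) :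
    primitive c (w • hm.toLp _) x = expSol w c x := by
  have h1 : ∫ t in (0 : ℝ)..x, Complex.I • (w • hm.toLp _ : L2 n) t
      = ∫ t in (0 : ℝ)..x, Complex.I • w • expSol w c t := by
    refine intervalIntegral.integral_congr_ae ?_
    filter_upwards [Lp.coeFn_smul w (hm.toLp _), hm.coeFn_toLp] with t h1 h2 ht
    rw [h1, Pi.smul_apply, h2, Set.indicator_of_mem (hx ht)]
  rw [primitive, h1, intervalIntegral.integral_eq_sub_of_hasDerivAt
    (fun t _ => hasDerivAt_expSol w c t)]
  · simp [expSol]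
  · exact (((continuous_expSol w c).const_smul w).const_smul Complex.I).intervalIntegrable _ _

theorem primitive_indicator_expSol_eq_zero {w : ℂ} {J : Set ℝ} {c : Cn n}
    (hm : MemLp (J.indicator (expSol w c)) 2 volume) {x : ℝ} (hx : Set.uIoc 0 x ⊆ Jᶜ) :
    primitive 0 (w • hm.toLp _) x = 0 := by
  rw [primitive, zero_add]
  refine intervalIntegral.integral_zero_ae ?_
  filter_upwards [Lp.coeFn_smul w (hm.toLp _), hm.coeFn_toLp] with t h1 h2 ht
  rw [h1, Pi.smul_apply, h2, Set.indicator_of_notMem (hx ht), smul_zero, smul_zero]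

theorem integrableOn_exp_Ioi {w : ℂ} (hw : 0 < w.im) :
    IntegrableOn (fun x => Real.exp (-(2 * w.im) * x)) (Set.Ioi 0) :=
  integrableOn_exp_mul_Ioi (by linarith) 0

theorem integrableOn_exp_Iic {w : ℂ} (hw : w.im < 0) :
    IntegrableOn (fun x => Real.exp (-(2 * w.im) * x)) (Set.Iic 0) :=
  integrableOn_exp_mul_Iic (by linarith) 0

theorem hasTraces_expSol_right {w : ℂ} {c : Cn n}
    (hm : MemLp ((Set.Ioi 0).indicator (expSol w c)) 2 volume) :
    HasTraces (hm.toLp _, w • hm.toLp _) c 0 := by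
  constructor
  · filter_upwards [ae_restrict_of_ae hm.coeFn_toLp, ae_restrict_mem measurableSet_Ioi]
      with x h1 (hx : 0 < x)
    rw [h1, Set.indicator_of_mem (show x ∈ Set.Ioi 0 from hx), primitive_indicator_expSol hm]
    rw [Set.uIoc_of_le hx.le]
    exact fun t ht => ht.1
  · filter_upwards [ae_restrict_of_ae hm.coeFn_toLp, ae_restrict_mem measurableSet_Iio]
      with x h1 (hx : x < 0)
    rw [h1, Set.indicator_of_notMem (by simpa using hx.le),
      primitive_indicator_expSol_eq_zero hm]
    rw [Set.uIoc_of_ge hx.le]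
    exact fun t ht => not_lt.2 ht.2

theorem hasTraces_expSol_left {w : ℂ} {c : Cn n}
    (hm : MemLp ((Set.Iic 0).indicator (expSol w c)) 2 volume) :
    HasTraces (hm.toLp _, w • hm.toLp _) 0 c := by
  constructor
  · filter_upwards [ae_restrict_of_ae hm.coeFn_toLp, ae_restrict_mem measurableSet_Ioi]
      with x h1 (hx : 0 < x)
    rw [h1, Set.indicator_of_notMem (by simpa using hx), primitive_indicator_expSol_eq_zero hm]
    rw [Set.uIoc_of_le hx.le]
    exact fun t ht => not_le.2 ht.1
  · filter_upwards [ae_restrict_of_ae hm.coeFn_toLp, ae_restrict_mem measurableSet_Iio]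
      with x h1 (hx : x < 0)
    rw [h1, Set.indicator_of_mem (by simpa using hx.le), primitive_indicator_expSol hm]
    rw [Set.uIoc_of_ge hx.le]
    exact fun t ht => ht.2

/-- The witness is e^{-x}a on the right half line and e^{x}b on the left one. -/
theorem exists_hasTraces (a b : Cn n) : ∃ p : L2 n × L2 n, HasTraces p a b := by
  have h1 := hasTraces_expSol_right (memLp_indicator_expSol measurableSet_Ioi
    (integrableOn_exp_Ioi (w := Complex.I) (by simp)) a)
  have h2 := hasTraces_expSol_left (memLp_indicator_expSol measurableSet_Iic
    (integrableOn_exp_Iic (w := -Complex.I) (by simp)) b)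
  exact ⟨_, by simpa using h1.add h2⟩

/-- A function orthogonal to all square integrable exponentials on a half line vanishes there. -/
theorem indicator_ae_eq_zero_of_inner_expSol {J : Set ℝ} (hJ : MeasurableSet J) {ε : ℝ}
    (hε : IntegrableOn (fun x => Real.exp (-(2 * ε) * x)) J) (v : L2 n)
    (h : ∀ (w : ℂ) (c : Cn n), w.im = ε → ∀ hm : MemLp (J.indicator (expSol w c)) 2 volume,
      (inner ℂ (hm.toLp _) v : ℂ) = 0) :
    J.indicator v =ᵐ[volume] 0 := by
  -- The damping factor is square integrable on `J`, so `F` is integrable and has a pointwise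
  -- Fourier transform.
  set F : ℝ → Cn n := J.indicator fun x => (Real.exp (-ε * x) : ℂ) • v x with hF
  have hexp : MemLp (J.indicator fun x : ℝ => (Real.exp (-ε * x) : ℂ)) 2 volume := by
    rw [memLp_indicator_iff_restrict hJ, memLp_two_iff_integrable_sq_norm
      (Continuous.aestronglyMeasurable (by fun_prop))]
    refine Integrable.congr hε (.of_forall fun x => ?_)
    dsimp only
    rw [Complex.norm_real, Real.norm_of_nonneg (Real.exp_pos _).le, ← Real.exp_nat_mul]
    congr 1
    push_cast
    ring
  have hFi : Integrable F volume := by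
    rw [← memLp_one_iff_integrable]
    have := (Lp.memLp v).smul (r := 1) hexp
    refine this.ae_eq (.of_forall fun x => ?_)
    by_cases hx : x ∈ J <;> simp [hF, hx]
  have hFz : F =ᵐ[volume] 0 := by
    refine ae_eq_zero_of_fourier_eq_zero hFi fun s => ?_
    rw [Real.fourier_real_eq_integral_exp_smul]
    refine ext_inner_left ℂ fun c => ?_
    -- The conjugate of e^{iwx} is e^{-2πisx}e^{-εx}, so pairing this exponential with `v` gives the
    -- Fourier transform of `F` at s, tested against `c`.
    set w : ℂ := (2 * Real.pi * s : ℝ) + ε * Complex.I with hw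
    have hwim : w.im = ε := by simp [hw]
    have hm : MemLp (J.indicator (expSol w c)) 2 volume :=
      memLp_indicator_expSol hJ (by rwa [hwim]) c
    have h1 := h w c hwim hm
    have hint : Integrable
        (fun v : ℝ => Complex.exp ((-2 * Real.pi * v * s : ℝ) * Complex.I) • F v) volume := by
      refine hFi.bdd_smul
        (φ := fun v : ℝ => Complex.exp ((-2 * Real.pi * v * s : ℝ) * Complex.I)) 1 (Continuous.aestronglyMeasurable (by fun_prop)) ?_
      exact .of_forall fun x => (Complex.norm_exp_ofReal_mul_I _).le
    have h2 : ∫ x, (inner ℂ c (Complex.exp ((-2 * Real.pi * x * s : ℝ) * Complex.I) • F x) : ℂ)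
        = inner ℂ c (∫ x, Complex.exp ((-2 * Real.pi * x * s : ℝ) * Complex.I) • F x) :=
      (innerSL ℂ c).integral_comp_comm hint
    rw [inner_zero_right, ← h2, ← h1, L2.inner_def]
    refine integral_congr_ae ?_
    filter_upwards [hm.coeFn_toLp] with x hx
    rw [hx]
    by_cases hxJ : x ∈ J
    · rw [hF, Set.indicator_of_mem hxJ, Set.indicator_of_mem hxJ, expSol, smul_smul,
        inner_smul_left, inner_smul_right, ← Complex.exp_conj, Complex.ofReal_exp,
        ← Complex.exp_add]
      congr 2
      simp only [hw, map_mul, map_add, Complex.conj_I, Complex.conj_ofReal]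
      push_cast
      linear_combination (-(ε : ℂ) * x) * Complex.I_sq
    · rw [hF, Set.indicator_of_notMem hxJ, Set.indicator_of_notMem hxJ]
      simp
  filter_upwards [hFz] with x hx
  by_cases hxJ : x ∈ J
  · rw [hF, Set.indicator_of_mem hxJ] at hx
    simpa [hxJ, Complex.exp_ne_zero] using hx
  · simp [hxJ]

/-- Exponentials with Im w = 1 suffice on the right half line, and those with Im w = -1 on the left
one. -/
theorem eq_zero_of_inner_eq_zero (v : L2 n)
    (h : ∀ (g : L2 n) (w : ℂ) (a b : Cn n), w.im ≠ 0 → HasTraces (g, w • g) a b →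
      (inner ℂ g v : ℂ) = 0) : v = 0 := by
  have h1 := indicator_ae_eq_zero_of_inner_expSol measurableSet_Ioi (ε := 1)
    (by simpa using integrableOn_exp_Ioi (w := Complex.I) (by simp)) v
    fun w c hw hm => h _ w _ _ (by simp [hw]) (hasTraces_expSol_right hm)
  have h2 := indicator_ae_eq_zero_of_inner_expSol measurableSet_Iic (ε := -1)
    (by simpa using integrableOn_exp_Iic (w := -Complex.I) (by simp)) v
    fun w c hw hm => h _ w _ _ (by simp [hw]) (hasTraces_expSol_left hm)
  rw [Lp.eq_zero_iff_ae_eq_zero]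
  filter_upwards [h1, h2] with x hx1 hx2
  rcases lt_or_ge 0 x with hx | hx
  · rwa [Set.indicator_of_mem (show x ∈ Set.Ioi 0 from hx)] at hx1
  · rwa [Set.indicator_of_mem (show x ∈ Set.Iic 0 from hx)] at hx2

end FirstOrder

/-! ### Selfadjoint linear relations and their resolvents. -/

namespace LinRel

variable {H : Type*} [NormedAddCommGroup H] [InnerProductSpace ℂ H]

theorem mem_inverseShift {L : Submodule ℂ (H × H)} {z : ℂ} {x y : H} :
    (x, y) ∈ inverseShift L z ↔ (y, x + z • y) ∈ L := by
  constructor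
  · rintro ⟨⟨a, b⟩, hab, h⟩
    obtain ⟨h1, h2⟩ := Prod.ext_iff.1 h
    have h1' : b - z • a = x := h1
    have h2' : a = y := h2
    subst h2'
    rw [← h1', sub_add_cancel]
    exact hab
  · intro h
    exact ⟨(y, x + z • y), h, by simp⟩

theorem isResolventAt_iff {L : Submodule ℂ (H × H)} {z : ℂ} {R : H →L[ℂ] H} :
    IsResolventAt L z R ↔ ∀ x y, (y, x + z • y) ∈ L ↔ y = R x := by
  rw [IsResolventAt, Submodule.ext_iff]
  simp only [Prod.forall, mem_inverseShift, LinearMap.mem_graph_iff, ContinuousLinearMap.coe_coe]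

theorem IsResolventAt.mem {L : Submodule ℂ (H × H)} {z : ℂ} {R : H →L[ℂ] H}
    (h : IsResolventAt L z R) (x : H) : (R x, x + z • R x) ∈ L :=
  (isResolventAt_iff.1 h _ _).2 rfl

variable {L : Submodule ℂ (H × H)}

theorem inner_eq_of_adjoint_eq (hL : L.adjoint = L) {p q : H × H} (hp : p ∈ L) (hq : q ∈ L) :
    (inner ℂ p.1 q.2 : ℂ) = inner ℂ p.2 q.1 := by
  rw [← hL, Submodule.mem_adjoint_iff] at hq
  exact (sub_eq_zero.1 (hq p.1 p.2 hp)).symm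

/-- ⟨y, x + zy⟩ is real, so Im z ‖y‖² = -Im⟨y, x⟩, and Cauchy–Schwarz applies. -/
theorem abs_im_mul_norm_le (hL : L.adjoint = L) {z : ℂ} {x y : H} (h : (y, x + z • y) ∈ L) :
    |z.im| * ‖y‖ ≤ ‖x‖ := by
  have h1 := inner_eq_of_adjoint_eq hL h h
  simp only [inner_add_left, inner_add_right, inner_smul_left, inner_smul_right] at h1
  rw [← inner_conj_symm x y, FirstOrder.inner_self_eq_ofReal] at h1
  have h2 := congrArg Complex.im h1
  simp only [Complex.add_im, Complex.im_mul_ofReal, Complex.conj_im] at h2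
  have h3 : z.im * ‖y‖ ^ 2 = -(inner ℂ y x : ℂ).im := by linarith
  have h4 : |z.im| * ‖y‖ ^ 2 ≤ ‖y‖ * ‖x‖ := by
    calc |z.im| * ‖y‖ ^ 2 = |z.im * ‖y‖ ^ 2| := by rw [abs_mul, abs_of_nonneg (sq_nonneg ‖y‖)]
      _ = |(inner ℂ y x : ℂ).im| := by rw [h3, abs_neg]
      _ ≤ ‖(inner ℂ y x : ℂ)‖ := Complex.abs_im_le_norm _
      _ ≤ ‖y‖ * ‖x‖ := norm_inner_le_norm _ _
  rcases (norm_nonneg y).eq_or_lt with h0 | h0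
  · rw [← h0, mul_zero]; exact norm_nonneg x
  · refine le_of_mul_le_mul_left ?_ h0
    linarith

theorem isClosed_of_adjoint_eq (hL : L.adjoint = L) : IsClosed (L : Set (H × H)) := by
  have : (L : Set (H × H))
      = ⋂ p ∈ L, {q : H × H | (inner ℂ p.2 q.1 : ℂ) - inner ℂ p.1 q.2 = 0} := by
    ext q
    simp only [Set.mem_iInter, SetLike.mem_coe, Set.mem_ofPred_eq]
    nth_rewrite 1 [← hL]
    rw [Submodule.mem_adjoint_iff]
    exact ⟨fun h p hp => h p.1 p.2 hp, fun h a b hab => h (a, b) hab⟩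
  rw [this]
  exact isClosed_biInter fun p _ => isClosed_eq (by fun_prop) continuous_const

variable [CompleteSpace H]

/-- Non-real numbers belong to the resolvent set of a selfadjoint linear relation. -/
theorem exists_isResolventAt (hL : L.adjoint = L) {z : ℂ} (hz : z.im ≠ 0) :
    ∃ R : H →L[ℂ] H, IsResolventAt L z R := by
  have hzpos : 0 < |z.im| := abs_pos.2 hz
  set F : (H × H) →L[ℂ] H := ContinuousLinearMap.snd ℂ H H - z • ContinuousLinearMap.fst ℂ H H
    with hF
  set f : L →L[ℂ] H := F.comp L.subtypeL with hf
  have hfa : ∀ p : L, f p = p.1.2 - z • p.1.1 := fun p => rfl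
  have hmem : ∀ p : L, (p.1.1, f p + z • p.1.1) ∈ L := fun p => by
    rw [hfa, sub_add_cancel]; exact p.2
  have hb : ∀ p : L, ‖p.1.1‖ ≤ |z.im|⁻¹ * ‖f p‖ := fun p => by
    rw [← div_eq_inv_mul, le_div_iff₀ hzpos, mul_comm]
    exact abs_im_mul_norm_le hL (hmem p)
  have hcompl : CompleteSpace L := (isClosed_of_adjoint_eq hL).completeSpace_coe
  -- The product carries the maximum norm; the two entries bound the two components of an element of
  -- `L`.
  set C : ℝ := max (|z.im|⁻¹) (1 + ‖z‖ * |z.im|⁻¹)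
  have hC : 0 ≤ C := le_max_of_le_left (by positivity)
  have hanti : AntilipschitzWith C.toNNReal f := by
    refine f.antilipschitz_of_bound fun p => ?_
    rw [Real.coe_toNNReal _ hC]
    change max ‖p.1.1‖ ‖p.1.2‖ ≤ _
    refine max_le ((hb p).trans ?_) ?_
    · gcongr; exact le_max_left _ _
    · have h2 : p.1.2 = f p + z • p.1.1 := by rw [hfa, sub_add_cancel]
      calc ‖p.1.2‖ ≤ ‖f p‖ + ‖z • p.1.1‖ := by rw [h2]; exact norm_add_le _ _
        _ ≤ ‖f p‖ + ‖z‖ * (|z.im|⁻¹ * ‖f p‖) := by rw [norm_smul]; gcongr; exact hb p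
        _ = (1 + ‖z‖ * |z.im|⁻¹) * ‖f p‖ := by ring
        _ ≤ C * ‖f p‖ := by gcongr; exact le_max_right _ _
  have hclosed : IsClosed (f.range : Set H) := by
    have := hanti.isClosed_range f.uniformContinuous
    exact this
  have hrange : f.range = ⊤ := by
    rw [← hclosed.submodule_topologicalClosure_eq, Submodule.topologicalClosure_eq_top_iff,
      Submodule.eq_bot_iff]
    intro u hu
    -- A vector orthogonal to the range of L - z is an eigenvector of L* = L for the conjugate of z,
    -- which the norm bound excludes unless it is 0.
    have hu' : (u, (starRingEnd ℂ) z • u) ∈ L := by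
      rw [← hL, Submodule.mem_adjoint_iff]
      intro a b hab
      have h1 := (Submodule.mem_orthogonal _ _).1 hu (f ⟨(a, b), hab⟩) ⟨_, rfl⟩
      rw [hfa, inner_sub_left, inner_smul_left] at h1
      rw [inner_smul_right]
      exact h1
    have h2 := abs_im_mul_norm_le hL (x := 0) (y := u) (z := (starRingEnd ℂ) z)
      (by rwa [zero_add])
    rw [norm_zero, Complex.conj_im, abs_neg] at h2
    have h3 : ‖u‖ ≤ 0 := by
      by_contra h
      exact absurd h2 (not_le.2 (mul_pos hzpos (not_le.1 h)))
    exact norm_le_zero_iff.1 h3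
  have hbij : Function.Bijective (f : L →ₗ[ℂ] H) :=
    ⟨hanti.injective, LinearMap.range_eq_top.1 hrange⟩
  set e := LinearEquiv.ofBijective (f : L →ₗ[ℂ] H) hbij
  have he : ∀ x, f (e.symm x) = x := fun x => e.apply_symm_apply x
  refine ⟨LinearMap.mkContinuous (LinearMap.fst ℂ H H ∘ₗ L.subtype ∘ₗ e.symm.toLinearMap)
    (|z.im|⁻¹) fun x => ?_, isResolventAt_iff.2 fun x y => ?_⟩
  · have := hb (e.symm x)
    rwa [he] at this
  · constructor
    · intro h
      have h1 : f ⟨_, h⟩ = x := by rw [hfa]; simp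
      have h2 : e.symm x = ⟨_, h⟩ := (LinearEquiv.symm_apply_eq e).2 h1.symm
      change y = (e.symm x).1.1
      rw [h2]
    · intro h
      have h' : y = (e.symm x).1.1 := h
      have := hmem (e.symm x)
      rwa [he, ← h'] at this

end LinRel

/-! ### The matrices Re D, Im D and (-Im D)^{1/2}. -/

namespace FirstOrder

open scoped MatrixOrder

variable {n : ℕ} {D : Matrix (Fin n) (Fin n) ℂ}

theorem toEuclideanLin_apply_eq (D : Matrix (Fin n) (Fin n) ℂ) (x : Cn n) :
    Matrix.toEuclideanLin D x = Matrix.toEuclideanLin (ℜ D : Matrix (Fin n) (Fin n) ℂ) x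
      + Complex.I • Matrix.toEuclideanLin (ℑ D : Matrix (Fin n) (Fin n) ℂ) x := by
  conv_lhs => rw [← realPart_add_I_smul_imaginaryPart D, map_add, map_smul]
  rfl

theorem isSymmetric_realPart (D : Matrix (Fin n) (Fin n) ℂ) :
    (Matrix.toEuclideanLin (ℜ D : Matrix (Fin n) (Fin n) ℂ)).IsSymmetric :=
  Matrix.isSymmetric_toEuclideanLin_iff.2 (ℜ D).2

theorem isSymmetric_imaginaryPart (D : Matrix (Fin n) (Fin n) ℂ) :
    (Matrix.toEuclideanLin (ℑ D : Matrix (Fin n) (Fin n) ℂ)).IsSymmetric :=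
  Matrix.isSymmetric_toEuclideanLin_iff.2 (ℑ D).2

theorem nonneg_neg_imaginaryPart (hD : LinRel.IsDissipative (Matrix.toEuclideanLin D).graph) :
    0 ≤ -(ℑ D : Matrix (Fin n) (Fin n) ℂ) := by
  refine Matrix.PosSemidef.nonneg (Matrix.isPositive_toEuclideanLin_iff.1 ⟨?_, fun x => ?_⟩)
  · rw [map_neg]
    exact fun x y => by simp [isSymmetric_imaginaryPart D x y]
  · have h := hD (x, Matrix.toEuclideanLin D x) (by simp)
    have h1 : (inner ℂ x (Matrix.toEuclideanLin (ℜ D : Matrix (Fin n) (Fin n) ℂ) x) : ℂ).im = 0 := by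
      have := (isSymmetric_realPart D).im_inner_self_apply x
      simpa using this
    rw [toEuclideanLin_apply_eq, inner_add_right, inner_smul_right, Complex.add_im, h1, zero_add,
      Complex.I_mul_im] at h
    rw [map_neg, LinearMap.neg_apply, inner_neg_left, isSymmetric_imaginaryPart D x x]
    simpa using h

theorem sqrtNegIm_mul_self (hD : LinRel.IsDissipative (Matrix.toEuclideanLin D).graph) :
    sqrtNegIm D * sqrtNegIm D = -(ℑ D : Matrix (Fin n) (Fin n) ℂ) :=
  CFC.sqrt_mul_sqrt_self _ (nonneg_neg_imaginaryPart hD)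

theorem isSymmetric_sqrtNegIm (D : Matrix (Fin n) (Fin n) ℂ) :
    (Matrix.toEuclideanLin (sqrtNegIm D)).IsSymmetric :=
  Matrix.isSymmetric_toEuclideanLin_iff.2 
    (IsSelfAdjoint.of_nonneg (CFC.sqrt_nonneg (-(ℑ D : Matrix (Fin n) (Fin n) ℂ))))

theorem toEuclideanLin_eq_sub (hD : LinRel.IsDissipative (Matrix.toEuclideanLin D).graph)
    (x : Cn n) :
    Matrix.toEuclideanLin D x = Matrix.toEuclideanLin (ℜ D : Matrix (Fin n) (Fin n) ℂ) x
      - Complex.I • Matrix.toEuclideanLin (sqrtNegIm D)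
        (Matrix.toEuclideanLin (sqrtNegIm D) x) := by
  have h : Matrix.toEuclideanLin (sqrtNegIm D) (Matrix.toEuclideanLin (sqrtNegIm D) x)
      = -Matrix.toEuclideanLin (ℑ D : Matrix (Fin n) (Fin n) ℂ) x := by
    rw [← LinearMap.neg_apply, ← map_neg, ← sqrtNegIm_mul_self hD, Matrix.toLpLin_mul_same]
    rfl
  rw [h, toEuclideanLin_apply_eq, smul_neg, sub_neg_eq_add]

theorem isUnit_det_sqrtNegIm (hD : LinRel.IsDissipative (Matrix.toEuclideanLin D).graph)
    (hImD : LinearMap.ker (Matrix.toEuclideanLin (ℑ D : Matrix (Fin n) (Fin n) ℂ)) = ⊥) :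
    IsUnit (sqrtNegIm D).det := by
  have h : IsUnit (ℑ D : Matrix (Fin n) (Fin n) ℂ) := by
    rw [← Matrix.mulVec_injective_iff_isUnit]
    intro x y hxy
    have := LinearMap.ker_eq_bot.1 hImD (a₁ := WithLp.toLp 2 x) (a₂ := WithLp.toLp 2 y)
      (by simpa [Matrix.toLpLin_toLp] using hxy)
    simpa using this
  rw [← IsUnit.neg_iff, ← sqrtNegIm_mul_self hD, Matrix.isUnit_iff_isUnit_det, Matrix.det_mul] at h
  exact isUnit_of_mul_isUnit_left h

theorem sqrtNegIm_inv_apply (h : IsUnit (sqrtNegIm D).det) (x : Cn n) :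
    Matrix.toEuclideanLin (sqrtNegIm D)⁻¹ (Matrix.toEuclideanLin (sqrtNegIm D) x) = x := by
  rw [← LinearMap.comp_apply, ← Matrix.toLpLin_mul_same, Matrix.nonsing_inv_mul _ h,
    Matrix.toLpLin_one, LinearMap.id_apply]

theorem sqrtNegIm_apply_inv (h : IsUnit (sqrtNegIm D).det) (x : Cn n) :
    Matrix.toEuclideanLin (sqrtNegIm D) (Matrix.toEuclideanLin (sqrtNegIm D)⁻¹ x) = x := by
  rw [← LinearMap.comp_apply, ← Matrix.toLpLin_mul_same, Matrix.mul_nonsing_inv _ h,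
    Matrix.toLpLin_one, LinearMap.id_apply]

end FirstOrder

namespace LinRel

variable {H : Type*} [NormedAddCommGroup H] [InnerProductSpace ℂ H] [CompleteSpace H]

/-- The domain is dense: if u is orthogonal to it, then {0, u} lies in the adjoint relation, which
is the graph itself, so u = 0. -/
theorem isSelfAdjoint_of_graph_adjoint_eq {L : H →ₗ.[ℂ] H} (hL : L.graph.adjoint = L.graph) :
    IsSelfAdjoint L := by
  have hd : Dense (L.domain : Set H) := by
    rw [Submodule.dense_iff_topologicalClosure_eq_top, Submodule.topologicalClosure_eq_top_iff,
      Submodule.eq_bot_iff]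
    intro u hu
    have h : ((0 : H), u) ∈ L.graph := by
      rw [← hL, Submodule.mem_adjoint_iff]
      intro a b hab
      rw [inner_zero_right, (Submodule.mem_orthogonal _ _).1 hu a
        (LinearPMap.mem_domain_of_mem_graph hab), sub_zero]
    exact L.graph_fst_eq_zero_snd h rfl
  rw [LinearPMap.isSelfAdjoint_def]
  apply LinearPMap.eq_of_eq_graph
  rw [LinearPMap.adjoint_graph_eq_graph_adjoint hd, hL]

end LinRel

/-! ### The boundary maps Υ₀ and Υ₁. -/

namespace FirstOrder

variable {n : ℕ} {D : Matrix (Fin n) (Fin n) ℂ}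

theorem inv_sqrt_two_mul_self : (1 / (Real.sqrt 2 : ℂ)) * (1 / (Real.sqrt 2 : ℂ)) = 1 / 2 := by
  rw [div_mul_div_comm, ← Complex.ofReal_mul, Real.mul_self_sqrt (by norm_num)]
  norm_num

theorem I_div_sqrt_two : Complex.I / (Real.sqrt 2 : ℂ) = Complex.I * (1 / (Real.sqrt 2 : ℂ)) := by
  ring

theorem conj_inv_sqrt_two :
    (starRingEnd ℂ) (1 / (Real.sqrt 2 : ℂ)) = 1 / (Real.sqrt 2 : ℂ) := by
  rw [map_div₀, map_one, Complex.conj_ofReal]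

/-- (-Im D)^{1/2} is symmetric and cancels against its inverse, so D disappears. -/
theorem inner_upsilon₀_upsilon₁ (h : IsUnit (sqrtNegIm D).det) (a b c d : Cn n) :
    (inner ℂ (upsilon₀ D a b) (upsilon₁ D c d) : ℂ)
      = Complex.I * (1 / 2) * inner ℂ (a - b) (c + d) := by
  rw [upsilon₀, upsilon₁, inner_smul_left, inner_smul_right, ← isSymmetric_sqrtNegIm D,
    sqrtNegIm_apply_inv h, conj_inv_sqrt_two, I_div_sqrt_two]
  linear_combination (Complex.I * inner ℂ (a - b) (c + d)) * inv_sqrt_two_mul_self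

theorem inner_upsilon₁_upsilon₀ (h : IsUnit (sqrtNegIm D).det) (a b c d : Cn n) :
    (inner ℂ (upsilon₁ D a b) (upsilon₀ D c d) : ℂ)
      = -Complex.I * (1 / 2) * inner ℂ (a + b) (c - d) := by
  rw [← inner_conj_symm, inner_upsilon₀_upsilon₁ h, map_mul, map_mul, inner_conj_symm,
    Complex.conj_I, map_div₀, map_one, Complex.conj_ofNat]

/-- `Υ₀` and `Υ₁` satisfy Green's identity. -/
theorem upsilon_green (h : IsUnit (sqrtNegIm D).det) {p q : L2 n × L2 n} {a b c d : Cn n}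
    (hp : HasTraces p a b) (hq : HasTraces q c d) :
    (inner ℂ p.1 q.2 : ℂ) - inner ℂ p.2 q.1
      = inner ℂ (upsilon₀ D a b) (upsilon₁ D c d) - inner ℂ (upsilon₁ D a b) (upsilon₀ D c d) := by
  rw [hp.green hq, inner_upsilon₀_upsilon₁ h, inner_upsilon₁_upsilon₀ h]
  simp only [inner_add_left, inner_add_right, inner_sub_left, inner_sub_right]
  ring

theorem sqrt_two_smul_upsilon₀ (h : IsUnit (sqrtNegIm D).det) (a b : Cn n) :
    (Real.sqrt 2 : ℂ) • Matrix.toEuclideanLin (sqrtNegIm D) (upsilon₀ D a b) = a - b := by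
  rw [upsilon₀, map_smul, sqrtNegIm_apply_inv h, smul_smul, mul_one_div_cancel, one_smul]
  exact Complex.ofReal_ne_zero.2 (by positivity)

theorem sqrt_two_smul_upsilon₁ (h : IsUnit (sqrtNegIm D).det) (a b : Cn n) :
    (-Complex.I * (Real.sqrt 2 : ℂ)) • Matrix.toEuclideanLin (sqrtNegIm D)⁻¹ (upsilon₁ D a b)
      = a + b := by
  have h2 : (Real.sqrt 2 : ℂ) ≠ 0 := Complex.ofReal_ne_zero.2 (by positivity)
  have e : (-Complex.I * (Real.sqrt 2 : ℂ)) * (Complex.I / (Real.sqrt 2 : ℂ)) = 1 := by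
    field_simp
    simp
  rw [upsilon₁, map_smul, sqrtNegIm_inv_apply h, smul_smul, e, one_smul]

theorem upsilon_injective (h : IsUnit (sqrtNegIm D).det) {a b c d : Cn n}
    (h0 : upsilon₀ D a b = upsilon₀ D c d) (h1 : upsilon₁ D a b = upsilon₁ D c d) :
    a = c ∧ b = d := by
  have e0 : a - b = c - d := by
    rw [← sqrt_two_smul_upsilon₀ h, h0, sqrt_two_smul_upsilon₀ h]
  have e1 : a + b = c + d := by
    rw [← sqrt_two_smul_upsilon₁ h, h1, sqrt_two_smul_upsilon₁ h]
  have ha : (2 : ℂ) • a = (2 : ℂ) • c := by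
    rw [two_smul, two_smul]
    calc a + a = a - b + (a + b) := by abel
      _ = c - d + (c + d) := by rw [e0, e1]
      _ = c + c := by abel
  have ha' : a = c := smul_right_injective _ (two_ne_zero (α := ℂ)) ha
  exact ⟨ha', by rw [ha'] at e1; exact add_left_cancel e1⟩

theorem upsilon_surjective (h : IsUnit (sqrtNegIm D).det) (x y : Cn n) :
    ∃ a b, upsilon₀ D a b = x ∧ upsilon₁ D a b = y := by
  have h2 : (Real.sqrt 2 : ℂ) ≠ 0 := Complex.ofReal_ne_zero.2 (by positivity)
  set u : Cn n := (Real.sqrt 2 : ℂ) • Matrix.toEuclideanLin (sqrtNegIm D) x with hu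
  set v : Cn n := (-Complex.I * (Real.sqrt 2 : ℂ)) • Matrix.toEuclideanLin (sqrtNegIm D)⁻¹ y
    with hv
  refine ⟨(1 / 2 : ℂ) • (v + u), (1 / 2 : ℂ) • (v - u), ?_, ?_⟩
  · have e : (1 / 2 : ℂ) • (v + u) - (1 / 2 : ℂ) • (v - u) = u := by module
    rw [upsilon₀, e, hu, map_smul, sqrtNegIm_inv_apply h, smul_smul, one_div_mul_cancel h2,
      one_smul]
  · have e : (1 / 2 : ℂ) • (v + u) + (1 / 2 : ℂ) • (v - u) = v := by module
    have e' : (Complex.I / (Real.sqrt 2 : ℂ)) * (-Complex.I * (Real.sqrt 2 : ℂ)) = 1 := by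
      field_simp
      simp
    rw [upsilon₁, e, hv, map_smul, sqrtNegIm_apply_inv h, smul_smul, e', one_smul]

@[simp]
theorem upsilon₀_zero (D : Matrix (Fin n) (Fin n) ℂ) : upsilon₀ D 0 0 = 0 := by simp [upsilon₀]

@[simp]
theorem upsilon₁_zero (D : Matrix (Fin n) (Fin n) ℂ) : upsilon₁ D 0 0 = 0 := by simp [upsilon₁]

/-- Outgoing boundary values satisfy the boundary condition `Γ₁ = D Γ₀`. -/
theorem toEuclideanLin_upsilon₀ (hD : LinRel.IsDissipative (Matrix.toEuclideanLin D).graph)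
    (h : IsUnit (sqrtNegIm D).det) (a : Cn n) :
    Matrix.toEuclideanLin D (upsilon₀ D a 0)
      = Matrix.toEuclideanLin (ℜ D : Matrix (Fin n) (Fin n) ℂ) (upsilon₀ D a 0)
        - upsilon₁ D a 0 := by
  rw [toEuclideanLin_eq_sub hD]
  congr 1
  rw [upsilon₀, upsilon₁, map_smul, map_smul, sub_zero, add_zero, sqrtNegIm_apply_inv h,
    smul_smul, I_div_sqrt_two]

/-- The relation `T*` is single-valued. -/
theorem HasTraces.eq_zero {w : L2 n} {a b : Cn n} (h : HasTraces (0, w) a b) :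
    a = 0 ∧ b = 0 ∧ w = 0 := by
  have ha : a = 0 := h.isBoundaryValue_right.unique isOpen_Ioi (.zero _)
  have hb : b = 0 := h.isBoundaryValue_left.unique isOpen_Iio (.zero _)
  subst ha hb
  refine ⟨rfl, rfl, eq_zero_of_inner_eq_zero w fun g z c d _ hg => ?_⟩
  have := hg.green h
  simpa using this

end FirstOrder

open FirstOrder

/-! ### Selfadjointness of the coupling and its boundary condition in the upper half plane. -/

section Coupling

variable {H : Type*} [NormedAddCommGroup H] [InnerProductSpace ℂ H] {n : ℕ}
  {S : Submodule ℂ (H × H)} {Pi : BoundaryTriplet S (Cn n)} {D : Matrix (Fin n) (Fin n) ℂ}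

theorem mem_couplingRelation_iff {p : WithLp 2 (H × L2 n) × WithLp 2 (H × L2 n)} :
    p ∈ couplingRelation Pi D ↔ ∃ (hf : (p.1.fst, p.2.fst) ∈ S.adjoint) (a b : Cn n),
      HasTraces (p.1.snd, p.2.snd) a b ∧ Pi.Γ₀ ⟨_, hf⟩ = upsilon₀ D a b ∧
      Pi.Γ₁ ⟨_, hf⟩ - Matrix.toEuclideanLin (ℜ D : Matrix (Fin n) (Fin n) ℂ) (Pi.Γ₀ ⟨_, hf⟩)
        = -upsilon₁ D a b := by
  constructor
  · rintro ⟨hf, a, b, h1, h2, h3, h4, h5⟩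
    exact ⟨hf, a, b, hasTraces_iff.2 ⟨h1, h2, h3⟩, h4, h5⟩
  · rintro ⟨hf, a, b, h1, h4, h5⟩
    exact ⟨hf, a, b, h1.mem_adjoint, h1.isBoundaryValue_right, h1.isBoundaryValue_left, h4, h5⟩

/-- Green's identity in `H ⊕ L²(ℝ, ℂⁿ)`. -/
theorem coupling_green (h : IsUnit (sqrtNegIm D).det)
    {p q : WithLp 2 (H × L2 n) × WithLp 2 (H × L2 n)}
    (hp : (p.1.fst, p.2.fst) ∈ S.adjoint) (hq : (q.1.fst, q.2.fst) ∈ S.adjoint)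
    {a b c d : Cn n} (tp : HasTraces (p.1.snd, p.2.snd) a b)
    (tq : HasTraces (q.1.snd, q.2.snd) c d) :
    (inner ℂ p.2 q.1 : ℂ) - inner ℂ p.1 q.2
      = inner ℂ (Pi.Γ₁ ⟨_, hp⟩) (Pi.Γ₀ ⟨_, hq⟩) - inner ℂ (Pi.Γ₀ ⟨_, hp⟩) (Pi.Γ₁ ⟨_, hq⟩)
        + inner ℂ (upsilon₁ D a b) (upsilon₀ D c d)
        - inner ℂ (upsilon₀ D a b) (upsilon₁ D c d) := by
  have h1 := Pi.green ⟨_, hq⟩ ⟨_, hp⟩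
  have h2 := upsilon_green h tp tq
  simp only at h1 h2
  rw [WithLp.prod_inner_apply, WithLp.prod_inner_apply]
  simp only [WithLp.ofLp_fst, WithLp.ofLp_snd]
  linear_combination -h1 - h2

theorem couplingRelation_le_adjoint (h : IsUnit (sqrtNegIm D).det) :
    couplingRelation Pi D ≤ (couplingRelation Pi D).adjoint := by
  intro q hq
  rw [Submodule.mem_adjoint_iff]
  intro u v huv
  obtain ⟨hf, a, b, h1, h2, h3⟩ := mem_couplingRelation_iff.1 huv
  obtain ⟨kf, c, d, k1, k2, k3⟩ := mem_couplingRelation_iff.1 hq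
  have e := coupling_green (Pi := Pi) h hf kf h1 k1
  refine e.trans ?_
  rw [sub_eq_iff_eq_add] at h3 k3
  rw [h3, k3, h2, k2]
  simp only [inner_add_left, inner_add_right, inner_neg_left, inner_neg_right]
  rw [isSymmetric_realPart D]
  ring

theorem adjoint_couplingRelation_le (h : IsUnit (sqrtNegIm D).det)
    (hS : ∀ p ∈ S, ∃ hp : p ∈ S.adjoint, Pi.Γ₀ ⟨p, hp⟩ = 0 ∧ Pi.Γ₁ ⟨p, hp⟩ = 0) :
    (couplingRelation Pi D).adjoint ≤ couplingRelation Pi D := by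
  intro q hq
  rw [Submodule.mem_adjoint_iff] at hq
  -- L contains S in the first component, as both boundary maps vanish on S; the same holds for T in
  -- the second.
  have kf : (q.1.fst, q.2.fst) ∈ S.adjoint := by
    rw [Submodule.mem_adjoint_iff]
    intro f f' hf
    obtain ⟨hf', h0, h1⟩ := hS _ hf
    have := hq (WithLp.toLp 2 (f, 0)) (WithLp.toLp 2 (f', 0)) <| by
      refine mem_couplingRelation_iff.2 ⟨hf', 0, 0, hasTraces_zero_of_mem_T (zero_mem _), ?_, ?_⟩
      · rw [upsilon₀_zero]; exact h0
      · rw [upsilon₁_zero, neg_zero]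
        refine (congrArg₂ (fun u v => u - Matrix.toEuclideanLin
          (ℜ D : Matrix (Fin n) (Fin n) ℂ) v) h1 h0).trans (by simp)
    simpa [WithLp.prod_inner_apply] using this
  have kt : (q.1.snd, q.2.snd) ∈ (T n).adjoint := by
    rw [Submodule.mem_adjoint_iff]
    intro g g' hg
    have := hq (WithLp.toLp 2 (0, g)) (WithLp.toLp 2 (0, g')) <| by
      have h0 : Pi.Γ₀ ⟨0, S.adjoint.zero_mem⟩ = 0 := map_zero Pi.Γ₀
      have h1 : Pi.Γ₁ ⟨0, S.adjoint.zero_mem⟩ = 0 := map_zero Pi.Γ₁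
      refine mem_couplingRelation_iff.2 ⟨S.adjoint.zero_mem, 0, 0,
        hasTraces_zero_of_mem_T hg, ?_, ?_⟩
      · rw [upsilon₀_zero]; exact h0
      · rw [upsilon₁_zero, neg_zero]
        refine (congrArg₂ (fun u v => u - Matrix.toEuclideanLin
          (ℜ D : Matrix (Fin n) (Fin n) ℂ) v) h1 h0).trans (by simp)
    simpa [WithLp.prod_inner_apply] using this
  obtain ⟨c, d, tq⟩ := exists_hasTraces_of_mem_adjoint kt
  set R := Matrix.toEuclideanLin (ℜ D : Matrix (Fin n) (Fin n) ℂ) with hR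
  -- Pairing with an element of L for which Γ₀ = Υ₀ = x, Υ₁ = y and hence Γ₁ = (Re D)x - y. Taking x
  -- = 0 yields the first coupling condition for q, and y = 0 the second.
  have key : ∀ x y : Cn n, (inner ℂ (R x - y) (Pi.Γ₀ ⟨_, kf⟩) : ℂ) - inner ℂ x (Pi.Γ₁ ⟨_, kf⟩)
      + inner ℂ y (upsilon₀ D c d) - inner ℂ x (upsilon₁ D c d) = 0 := by
    intro x y
    obtain ⟨⟨⟨f, f'⟩, hf⟩, hxy⟩ := Pi.surjective (x, R x - y)
    have h0 : Pi.Γ₀ ⟨(f, f'), hf⟩ = x := congrArg Prod.fst hxy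
    have h1 : Pi.Γ₁ ⟨(f, f'), hf⟩ = R x - y := congrArg Prod.snd hxy
    obtain ⟨a, b, ha, hb⟩ := upsilon_surjective h x y
    obtain ⟨⟨g, g'⟩, tp⟩ := exists_hasTraces a b
    have hp : (WithLp.toLp 2 (f, g), WithLp.toLp 2 (f', g')) ∈ couplingRelation Pi D := by
      refine mem_couplingRelation_iff.2 ⟨hf, a, b, tp, ?_, ?_⟩
      · rw [ha]; exact h0
      · rw [hb]
        refine (congrArg₂ (fun u v => u - R v) h1 h0).trans ?_
        simp
    have e := coupling_green (Pi := Pi) h (p := (WithLp.toLp 2 (f, g), WithLp.toLp 2 (f', g')))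
      hf kf tp tq
    rw [hq _ _ hp, ha, hb] at e
    erw [h0, h1] at e
    exact e.symm
  refine mem_couplingRelation_iff.2 ⟨kf, c, d, tq, ?_, ?_⟩
  · refine ext_inner_left ℂ fun y => ?_
    have := key 0 y
    simp only [map_zero, zero_sub, inner_neg_left, inner_zero_left, sub_zero] at this
    linear_combination -this
  · refine ext_inner_left ℂ fun x => ?_
    have := key x 0
    rw [sub_zero, inner_zero_left, isSymmetric_realPart D] at this
    rw [inner_sub_right, inner_neg_right]
    linear_combination -this

theorem adjoint_couplingRelation (h : IsUnit (sqrtNegIm D).det)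
    (hS : ∀ p ∈ S, ∃ hp : p ∈ S.adjoint, Pi.Γ₀ ⟨p, hp⟩ = 0 ∧ Pi.Γ₁ ⟨p, hp⟩ = 0) :
    (couplingRelation Pi D).adjoint = couplingRelation Pi D :=
  le_antisymm (adjoint_couplingRelation_le h hS) (couplingRelation_le_adjoint h)

theorem couplingRelation_singleValued
    (hA : ∀ (f' : H) (hf : ((0 : H), f') ∈ S.adjoint), Pi.Γ₀ ⟨_, hf⟩ = 0 → f' = 0)
    (p : WithLp 2 (H × L2 n) × WithLp 2 (H × L2 n)) (hp : p ∈ couplingRelation Pi D)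
    (h0 : p.1 = 0) : p.2 = 0 := by
  obtain ⟨u, v⟩ := p
  obtain rfl : u = 0 := h0
  obtain ⟨hf, a, b, h1, h2, h3⟩ := mem_couplingRelation_iff.1 hp
  obtain ⟨rfl, rfl, hv⟩ := HasTraces.eq_zero h1
  rw [upsilon₀_zero] at h2
  have hu := hA _ hf h2
  apply WithLp.ofLp_injective
  exact Prod.ext hu hv

/-- For `Im z > 0`, elements of `L` with `(L - z) (f, g) = (h, 0)` have `f` in the domain of `B`. -/
theorem boundary_condition_of_mem_couplingRelation
    (hD : LinRel.IsDissipative (Matrix.toEuclideanLin D).graph) (hu : IsUnit (sqrtNegIm D).det)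
    {z : ℂ} (hz : 0 < z.im) {x : H} {y : WithLp 2 (H × L2 n)}
    (h : (y, WithLp.toLp 2 (x, 0) + z • y) ∈ couplingRelation Pi D) :
    ∃ hf : (y.fst, x + z • y.fst) ∈ S.adjoint,
      Pi.Γ₁ ⟨_, hf⟩ = Matrix.toEuclideanLin D (Pi.Γ₀ ⟨_, hf⟩) := by
  obtain ⟨hf, a, b, h1, h2, h3⟩ := mem_couplingRelation_iff.1 h
  have h1' : HasTraces (y.snd, z • y.snd) a b := by
    have e : (WithLp.toLp 2 (x, (0 : L2 n)) + z • y).snd = z • y.snd := by simp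
    rw [← e]; exact h1
  obtain rfl := h1'.left_eq_zero hz
  refine ⟨hf, ?_⟩
  rw [sub_eq_iff_eq_add] at h3
  refine h3.trans ?_
  erw [h2]
  rw [toEuclideanLin_upsilon₀ hD hu]
  abel

end Coupling

/-! ### Minimality of the dilation. -/

section Minimality

variable {H : Type*} [NormedAddCommGroup H] [InnerProductSpace ℂ H] {n : ℕ}
  {S : Submodule ℂ (H × H)} {Pi : BoundaryTriplet S (Cn n)} {D : Matrix (Fin n) (Fin n) ℂ}

/-- A vector for which all `(L - z)⁻¹ x` belong to `L²(ℝ, ℂⁿ)` vanishes. -/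
theorem eq_zero_of_resolvent_fst_eq_zero (hu : IsUnit (sqrtNegIm D).det)
    (hL : (couplingRelation Pi D).adjoint = couplingRelation Pi D)
    (hA : ∀ (f' : H) (hf : ((0 : H), f') ∈ S.adjoint), Pi.Γ₀ ⟨_, hf⟩ = 0 → f' = 0)
    {x : WithLp 2 (H × L2 n)}
    (hx : ∀ z : ℂ, z.im ≠ 0 → ∃ y : WithLp 2 (H × L2 n), y.fst = 0 ∧
      (y, x + z • y) ∈ couplingRelation Pi D) : x = 0 := by
  have h1 : ∀ z : ℂ, z.im ≠ 0 → ∃ (g : L2 n) (a b : Cn n) (hf : ((0 : H), x.fst) ∈ S.adjoint),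
      |z.im| * ‖g‖ ≤ ‖x‖ ∧ HasTraces (g, x.snd + z • g) a b ∧ Pi.Γ₀ ⟨_, hf⟩ = upsilon₀ D a b ∧
      Pi.Γ₁ ⟨_, hf⟩ - Matrix.toEuclideanLin (ℜ D : Matrix (Fin n) (Fin n) ℂ) (Pi.Γ₀ ⟨_, hf⟩)
        = -upsilon₁ D a b := by
    intro z hz
    obtain ⟨y, hy0, hy⟩ := hx z hz
    have hb := LinRel.abs_im_mul_norm_le hL hy
    obtain ⟨hf, a, b, k1, k2, k3⟩ := mem_couplingRelation_iff.1 hy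
    -- The component of L - z in H reduces to {0, x.fst}, which no longer involves z.
    have e : (y.fst, (x + z • y).fst) = ((0 : H), x.fst) := by simp [hy0]
    have hf' : ((0 : H), x.fst) ∈ S.adjoint := e ▸ hf
    have e' : (⟨_, hf⟩ : S.adjoint) = ⟨_, hf'⟩ := Subtype.ext e
    refine ⟨y.snd, a, b, hf', (mul_le_mul_of_nonneg_left ?_ (abs_nonneg _)).trans hb, k1, ?_, ?_⟩
    · exact WithLp.norm_snd_le H y
    · rw [← e']; exact k2
    · rw [← e']; exact k3
  obtain ⟨-, a, b, hf, -, -, k2, k3⟩ := h1 Complex.I (by simp)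
  -- Υ is injective on pairs of traces, so the traces found at z = i serve for every nonreal z.
  have h2 : ∀ z : ℂ, z.im ≠ 0 → ∃ g : L2 n, |z.im| * ‖g‖ ≤ ‖x‖ ∧
      HasTraces (g, x.snd + z • g) a b := by
    intro z hz
    obtain ⟨g, a', b', hf', l0, l1, l2, l3⟩ := h1 z hz
    obtain ⟨rfl, rfl⟩ := upsilon_injective hu (k2.symm.trans l2)
      (neg_injective (k3.symm.trans l3))
    exact ⟨g, l0, l1⟩
  -- At z = it one has ‖g‖ ≤ ‖x‖/t while ‖x.snd + itg‖ ≤ 2‖x‖, so the trace estimate decays like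
  -- 1/t.
  have hbound : ∀ t : ℝ, 0 < t → ‖a‖ ^ 2 ≤ 4 * ‖x‖ ^ 2 / t ∧ ‖b‖ ^ 2 ≤ 4 * ‖x‖ ^ 2 / t := by
    intro t ht
    obtain ⟨g, l0, l1⟩ := h2 (t * Complex.I) (by simpa using ht.ne')
    have him : ((t : ℂ) * Complex.I).im = t := by simp
    rw [him, abs_of_pos ht] at l0
    have hg : ‖g‖ ≤ ‖x‖ / t := by rw [le_div_iff₀ ht]; linarith
    have hg' : ‖x.snd + ((t : ℂ) * Complex.I) • g‖ ≤ 2 * ‖x‖ := by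
      refine (norm_add_le _ _).trans ?_
      rw [norm_smul, norm_mul, Complex.norm_I, mul_one, Complex.norm_real,
        Real.norm_of_nonneg ht.le]
      have := WithLp.norm_snd_le H x
      linarith
    have hprod : 2 * (‖g‖ * ‖x.snd + ((t : ℂ) * Complex.I) • g‖) ≤ 4 * ‖x‖ ^ 2 / t := by
      calc 2 * (‖g‖ * ‖x.snd + ((t : ℂ) * Complex.I) • g‖)
          ≤ 2 * (‖x‖ / t * (2 * ‖x‖)) := by gcongr
        _ = 4 * ‖x‖ ^ 2 / t := by ring
    exact ⟨l1.norm_sq_right_le.trans hprod, l1.norm_sq_left_le.trans hprod⟩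
  have hlim : Tendsto (fun t : ℝ => 4 * ‖x‖ ^ 2 / t) atTop (𝓝 0) :=
    tendsto_const_nhds.div_atTop tendsto_id
  have ha : a = 0 := by
    have : ‖a‖ ^ 2 ≤ 0 := ge_of_tendsto hlim
      ((eventually_gt_atTop 0).mono fun t ht => (hbound t ht).1)
    simpa using le_antisymm this (sq_nonneg _)
  have hb : b = 0 := by
    have : ‖b‖ ^ 2 ≤ 0 := ge_of_tendsto hlim
      ((eventually_gt_atTop 0).mono fun t ht => (hbound t ht).2)
    simpa using le_antisymm this (sq_nonneg _)
  subst ha hb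
  rw [upsilon₀_zero] at k2
  have hfst : x.fst = 0 := hA _ hf k2
  -- For an exponential e with T*e = we, taking z as the conjugate of w cancels the terms with g in
  -- Green's identity and leaves ⟨e, x.snd⟩ = 0.
  have hsnd : x.snd = 0 := by
    refine eq_zero_of_inner_eq_zero _ fun e w c d hw he => ?_
    obtain ⟨g, -, hg⟩ := h2 ((starRingEnd ℂ) w) (by simpa using hw)
    have := he.green hg
    simp only [inner_zero_right, sub_self, mul_zero, inner_add_right, inner_smul_right,
      inner_smul_left] at this
    linear_combination this
  apply WithLp.ofLp_injective
  exact Prod.ext hfst hsnd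

/-- The adjoint of (L - z)⁻¹ is the resolvent at the conjugate of z, so orthogonality of x to the
span says that every (L - z)⁻¹x has zero component in H. -/
theorem span_resolvent_couplingRelation [CompleteSpace H] (hu : IsUnit (sqrtNegIm D).det)
    (hL : (couplingRelation Pi D).adjoint = couplingRelation Pi D)
    (hA : ∀ (f' : H) (hf : ((0 : H), f') ∈ S.adjoint), Pi.Γ₀ ⟨_, hf⟩ = 0 → f' = 0) :
    (Submodule.span ℂ {u : WithLp 2 (H × L2 n) |
      ∃ (z : ℂ) (R : WithLp 2 (H × L2 n) →L[ℂ] WithLp 2 (H × L2 n)) (h : H),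
        z.im ≠ 0 ∧ LinRel.IsResolventAt (couplingRelation Pi D) z R ∧
        u = R (WithLp.toLp 2 (h, 0))}).topologicalClosure = ⊤ := by
  rw [Submodule.topologicalClosure_eq_top_iff, Submodule.eq_bot_iff]
  intro x hx
  refine eq_zero_of_resolvent_fst_eq_zero hu hL hA fun z hz => ?_
  obtain ⟨R, hR⟩ := LinRel.exists_isResolventAt hL hz
  have hz' : ((starRingEnd ℂ) z).im ≠ 0 := by simpa using hz
  obtain ⟨R', hR'⟩ := LinRel.exists_isResolventAt hL hz'
  refine ⟨R x, ?_, hR.mem x⟩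
  refine ext_inner_left ℂ fun h => ?_
  have h1 := (Submodule.mem_orthogonal _ _).1 hx _
    (Submodule.subset_span ⟨_, R', h, hz', hR', rfl⟩)
  have h2 := LinRel.inner_eq_of_adjoint_eq hL (hR'.mem (WithLp.toLp 2 (h, 0))) (hR.mem x)
  simp only [inner_add_right, inner_add_left, inner_smul_right, inner_smul_left,
    Complex.conj_conj, h1, zero_add] at h2
  have h3 : (inner ℂ (WithLp.toLp 2 (h, (0 : L2 n))) (R x) : ℂ) = 0 := by
    linear_combination -h2
  simpa [WithLp.prod_inner_apply] using h3

end Minimality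

/-! ### Assembly: the operator L and the compression of its resolvent. -/

theorem theorem4p2 {H : Type*} [NormedAddCommGroup H] [InnerProductSpace ℂ H] [CompleteSpace H]
    (n : ℕ) (A B : H →ₗ.[ℂ] H)
    (hA : IsSelfAdjoint A) (hB : LinRel.IsMaximalDissipative B.graph)
    (hAB : ∃ (z : ℂ) (RA RB : H →L[ℂ] H),
      LinRel.IsResolventAt A.graph z RA ∧ LinRel.IsResolventAt B.graph z RB ∧
      LinearMap.rank ((RB - RA : H →L[ℂ] H) : H →ₗ[ℂ] H) = (n : Cardinal))
    (Pi : BoundaryTriplet (A.graph ⊓ B.graph) (FirstOrder.Cn n))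
    (D : Matrix (Fin n) (Fin n) ℂ)
    (hD : LinRel.IsDissipative (Matrix.toEuclideanLin D).graph)
    (hImD : LinearMap.ker (Matrix.toEuclideanLin (ℑ D : Matrix (Fin n) (Fin n) ℂ)) = ⊥)
    (hAΓ : A.graph = (LinearMap.ker Pi.Γ₀).map (Submodule.subtype _))
    (hBΓ : B.graph =
      (LinearMap.ker (Pi.Γ₁ - Matrix.toEuclideanLin D ∘ₗ Pi.Γ₀)).map (Submodule.subtype _)) :
    ∃ L : WithLp 2 (H × FirstOrder.L2 n) →ₗ.[ℂ] WithLp 2 (H × FirstOrder.L2 n),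
      L.graph = couplingRelation Pi D ∧ IsMinimalSelfadjointDilation L B := by
  have hu := isUnit_det_sqrtNegIm hD hImD
  have hmemA : ∀ p, p ∈ A.graph ↔ ∃ hp : p ∈ (A.graph ⊓ B.graph).adjoint, Pi.Γ₀ ⟨p, hp⟩ = 0 := by
    intro p
    conv_lhs => rw [hAΓ]
    simp
  have hmemB : ∀ p, p ∈ B.graph ↔ ∃ hp : p ∈ (A.graph ⊓ B.graph).adjoint,
      Pi.Γ₁ ⟨p, hp⟩ = Matrix.toEuclideanLin D (Pi.Γ₀ ⟨p, hp⟩) := by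
    intro p
    conv_lhs => rw [hBΓ]
    simp [sub_eq_zero]
  have hS : ∀ p ∈ A.graph ⊓ B.graph, ∃ hp : p ∈ (A.graph ⊓ B.graph).adjoint,
      Pi.Γ₀ ⟨p, hp⟩ = 0 ∧ Pi.Γ₁ ⟨p, hp⟩ = 0 := by
    rintro p ⟨hpA, hpB⟩
    obtain ⟨hp, h0⟩ := (hmemA p).1 hpA
    obtain ⟨hp', h1⟩ := (hmemB p).1 hpB
    exact ⟨hp, h0, by rw [h1, h0, map_zero]⟩
  have hA0 : ∀ (f' : H) (hf : ((0 : H), f') ∈ (A.graph ⊓ B.graph).adjoint),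
      Pi.Γ₀ ⟨_, hf⟩ = 0 → f' = 0 := fun f' hf h0 =>
    A.graph_fst_eq_zero_snd ((hmemA _).2 ⟨hf, h0⟩) rfl
  have hL := adjoint_couplingRelation (Pi := Pi) (D := D) hu hS
  have hgraph : (couplingRelation Pi D).toLinearPMap.graph = couplingRelation Pi D :=
    Submodule.toLinearPMap_graph_eq _ (couplingRelation_singleValued hA0)
  refine ⟨(couplingRelation Pi D).toLinearPMap, hgraph, ?_, ?_, ?_⟩
  · exact LinRel.isSelfAdjoint_of_graph_adjoint_eq (by rw [hgraph, hL])
  · intro z hz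
    rw [hgraph]
    obtain ⟨R, hR⟩ := LinRel.exists_isResolventAt hL hz.ne'
    set e := WithLp.prodContinuousLinearEquiv 2 ℂ H (L2 n)
    set Q : H →L[ℂ] H := ContinuousLinearMap.fst ℂ H (L2 n) ∘L
      (e : WithLp 2 (H × L2 n) →L[ℂ] H × L2 n) ∘L R ∘L
      (e.symm : (H × L2 n) →L[ℂ] WithLp 2 (H × L2 n)) ∘L ContinuousLinearMap.inl ℂ H (L2 n)
    have hQ : ∀ h : H, (R (WithLp.toLp 2 (h, 0))).fst = Q h := fun h => rfl
    refine ⟨R, Q, hR, LinRel.isResolventAt_iff.2 fun x y => ?_, hQ⟩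
    have hQB : (Q x, x + z • Q x) ∈ B.graph :=
      (hmemB _).2 (boundary_condition_of_mem_couplingRelation hD hu hz (hR.mem _))
    refine ⟨fun hy => ?_, fun hy => hy ▸ hQB⟩
    -- Two solutions of (B - z)y = x differ by an eigenvector of B for z; dissipativity and Im z > 0
    -- make it vanish.
    have hd := hB.1 _ (B.graph.sub_mem hy hQB)
    have e2 : (y, x + z • y) - (Q x, x + z • Q x) = (y - Q x, z • (y - Q x)) := by
      rw [Prod.mk_sub_mk, smul_sub]
      congr 1
      abel
    rw [e2] at hd
    simp only [inner_smul_right] at hd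
    rw [inner_self_eq_ofReal, Complex.im_mul_ofReal] at hd
    have h0 : ‖y - Q x‖ ^ 2 ≤ 0 := nonpos_of_mul_nonpos_right hd hz
    have h1 : ‖y - Q x‖ = 0 := by simpa using le_antisymm h0 (sq_nonneg _)
    exact sub_eq_zero.1 (norm_eq_zero.1 h1)
  · rw [hgraph]
    exact span_resolvent_couplingRelation hu hL hA0
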